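/- Let $(M,\rho)$ be a locally compact separable metric space. For $n\in\mathbb N$ let $\mathsf P^{(n)}_\bullet=(\mathsf P^{(n)}_t)_{t\ge 0}$ be a Feller transition function on $M^n$ (Markov kernels forming a semigroup with $\mathsf P^{(n)}_0=\mathrm{id}$, preserving $C_0(M^n)$, with $\mathsf P^{(n)}_tf(x)\to f(x)$ as $t\downarrow 0$ for $f\in C_0(M^n)$, $x\in M^n$). Assume: (TF1) for distinct indices $i_1,\dots,i_k\in\{1,\dots,n\}$ and $\pi x=(x_{i_1},\dots,x_{i_k})$, $\mathsf P^{(n)}_t(x,\pi^{-1}B)=\mathsf P^{(k)}_t(\pi x,B)$ for all $t\ge0$, $x\in M^n$ and Borel $B\subset M^k$; (TF2) $\mathsf P^{(2)}_t((x,x),\{(y,y):y\in M\})=1$ for all $x\in M$, $t\ge0$; (TF3) $\lim_{t\downarrow0}t^{-1}\sup_{x\in K}\mathsf P^{(1)}_t(x,\{y:\rho(x,y)>r\})=0$ for every compact $K\subset M$ and $r>0$. Let $F$ be the space of measurable maps $M\to M$ with the cylindrical $\sigma$-field, and let $\psi=(\psi_{s,t})_{s\le t}$ be a stochastic flow of measurable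 mappings associated to $(\mathsf P^{(n)}_\bullet)_n$, i.e. a family of random elements of $F$ on a probability space $(\Omega,\mathcal A,\mathbb P)$ such that (SF1) $\mathbb E f(\psi_{s,t}(x_1),\dots,\psi_{s,t}(x_n))=\mathsf P^{(n)}_{t-s}f(x)$ for all $s\le t$, $n$, $x\in M^n$, $f\in C_0(M^n)$; (SF2) there are measurable maps $\mathcal J_t:F\times M\to M$, $t\ge0$, with, for all $s\le t\le u$ and $x\in M$, $\mathcal J_{t-s}(\psi_{s,t},x)=\psi_{s,t}(x)$ a.s. and $\psi_{s,u}(x)=\mathcal J_{u-t}(\psi_{t,u},\psi_{s,t}(x))$ a.s.; and $\psi_{s,s}(x)=x$; (SF3) for $t_1\le\dots\le t_n$ the maps $\psi_{t_1,t_2},\dots,\psi_{t_{n-1},t_n}$ are independent; (SF4) $\lim_{(u,v)\to(s,t)}\sup_{x\in M}\mathbb E[(f(\psi_{u,v}(x))-f(\psi_{s,t}(x)))^2]=0$ for all $f\in C_0(M)$, $s\le t$; (SF5) $\lim_{y\to x}\mathbb E[(f(\psi_{s,t}(y))-f(\psi_{s,t}(x)))^2]=0$ and $\lim_{y\to\infty}\mathbb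 E[f(\psi_{s,t}(y))^2]=0$ for all $f\in C_0(M)$, $x\in M$, $s\le t$. Let $X$ be the space of continuous paths $f:[s,\infty)\to M$, $s\in\mathbb R$, where $f_j\to f$ means that the starting times converge and that the paths, extended to $\mathbb R$ by their initial values, converge locally uniformly; $X$ carries its Borel $\sigma$-field. Let $((s_n,x_n))_{n\in\mathbb N}$ be dense in $\mathbb R\times M$, and let $\varPhi=(\varPhi_n)_{n\in\mathbb N}$ be a random element of $X^{\mathbb N}$ such that $\varPhi_n:[s_n,\infty)\to M$ is a continuous modification of $t\mapsto\psi_{s_n,t}(x_n)$ with $\varPhi_n(s_n)=x_n$. Assume (TF4) almost surely $\varPhi$ is a skeleton, i.e. (a) if $s_m,s_n\le s$ and $\varPhi_m(s)=\varPhi_n(s)$ then $\varPhi_m=\varPhi_n$ on $[s,\infty)$; (b) $\{(s_n,\varPhi_n(s_n)):n\in\mathbb N\}$ is dense in $\mathbb R\times M$; (c) for every compact $L\subset\mathbb R\times M$ the set of all restrictions $\varPhi_n|_{[s,\infty)}$ with $s_n\le s$ and $(s,\varPhi_n(s))\in L$ is relatively compact in $X$. For $(x,y)\in M^2$ let $\mathbb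 P^{(2)}_{(x,y)}$ be the law on $C([0,\infty):M^2)$ under which the canonical process $(X,Y)$ is a Markov process with transition function $\mathsf P^{(2)}_\bullet$ started from $(x,y)$. A compact set $K\subset M$ is said to satisfy $\mathcal P$ if there are constants $\alpha,\beta,\kappa,p,C\in(0,\infty)$ with $\alpha\kappa>1$ such that (P1) for all $\varepsilon>0$ and $(x,y)\in K^2$ with $\rho(x,y)\le\varepsilon$, $\ \mathbb P^{(2)}_{(x,y)}[\sigma\wedge\tau>\beta\varepsilon^\alpha]\le 1-p$, where $\sigma=\inf\{t:(X_t,Y_t)\notin K^2\}$ and $\tau=\inf\{t:X_t=Y_t\}$; (P2) for all $n\ge2$ and every $A\subset K$ with $\#A\ge n$ there are $x\ne y$ in $A$ with $\rho(x,y)\le Cn^{-\kappa}$. **Proposition.** Let $(K_l)_{l\in\mathbb N}$ be an increasing sequence of compact subsets of $M$ whose interiors cover $M$ (equivalently, every compact subset of $M$ is contained in some $K_l$). Suppose that (i) every $K_l$ satisfies $\mathcal P$; (ii) a.s., for all $k\in\mathbb N$ and $s<t$ there are $l>k$ and $r\in(s,t)$ such that for all $n\in\mathbb N$: if $s_n\le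 s$ and $\varPhi_n(t)\in K_k$, then $\varPhi_n([r,t])\subset K_l$. Then a.s. $\varPhi$ has the instantaneous coalescence property: for all $s<t$ the set $\{\varPhi_n(t):n\in\mathbb N,\ s_n\le s\}$ is locally finite, i.e. every point of $M$ has a neighbourhood containing only finitely many of its points. -/

import Mathlib

open Set Filter Topology MeasureTheory ProbabilityTheory
open scoped NNReal ENNReal ZeroAtInfty

namespace StochFlow

noncomputable section

/-! ### Feller transition functions and coalescing consistent families -/

/-- A Feller transition function on `E`: a semigroup of Markov kernels that preserves `C₀(E, ℝ)`
and is (pointwise) continuous at time `0` on `C₀(E, ℝ)`. -/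
structure IsFeller {E : Type*} [TopologicalSpace E] [MeasurableSpace E]
    (P : ℝ≥0 → Kernel E E) : Prop where
  markov : ∀ t, IsMarkovKernel (P t)
  zero : P 0 = Kernel.id
  semigroup : ∀ s t, P (s + t) = P t ∘ₖ P s
  map_zeroAtInfty : ∀ (t : ℝ≥0) (f : C₀(E, ℝ)), ∃ g : C₀(E, ℝ), ∀ x, g x = ∫ y, f y ∂(P t x)
  tendsto_zero : ∀ (f : C₀(E, ℝ)) (x : E),
    Tendsto (fun t : ℝ≥0 => ∫ y, f y ∂(P t x)) (𝓝 0) (𝓝 (f x))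

/-- A consistent sequence of coalescing Feller transition functions, `P n` living on
`M ^ n = (Fin n → M)`. -/
structure IsCoalescingFamily {M : Type*} [TopologicalSpace M] [MeasurableSpace M]
    (P : (n : ℕ) → ℝ≥0 → Kernel (Fin n → M) (Fin n → M)) : Prop where
  feller : ∀ n, IsFeller (P n)
  consistent : ∀ (n k : ℕ) (i : Fin k → Fin n), Function.Injective i →
    ∀ (t : ℝ≥0) (x : Fin n → M) (B : Set (Fin k → M)), MeasurableSet B →
      P n t x {y | (fun j => y (i j)) ∈ B} = P k t (fun j => x (i j)) B
  coalescing : ∀ (x : M) (t : ℝ≥0), P 2 t ![x, x] {z | z 0 = z 1} = 1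

/-- The condition on the one-point transition function that gives continuous trajectories:
`t⁻¹ sup_{x ∈ K} P¹_t (x, {y : ρ(x, y) > r}) → 0` as `t ↓ 0`, for all compact `K` and `r > 0`. -/
def HasContinuousTrajectories {M : Type*} [MetricSpace M] [MeasurableSpace M]
    (P : (n : ℕ) → ℝ≥0 → Kernel (Fin n → M) (Fin n → M)) : Prop :=
  ∀ K : Set M, IsCompact K → ∀ r : ℝ, 0 < r →
    Tendsto (fun t : ℝ≥0 => (t : ℝ≥0∞)⁻¹ *
      ⨆ x ∈ K, P 1 t (fun _ => x) {y : Fin 1 → M | r < dist x (y 0)}) (𝓝[>] 0) (𝓝 0)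

/-! ### Stochastic flows of measurable mappings -/

/-- The space of measurable mappings `M → M`; as a subtype of `M → M` it carries the cylindrical
σ-field. -/
abbrev MeasMap (M : Type*) [MeasurableSpace M] : Type _ := {f : M → M // Measurable f}

/-- `ψ s t`, for `s ≤ t`, is a stochastic flow of measurable mappings on `M`, defined on the
probability space `(Ω, μ)`, with `n`-point transition functions `P n`. -/
structure IsStochasticFlow {M : Type*} [TopologicalSpace M] [MeasurableSpace M]
    {Ω : Type*} [MeasurableSpace Ω] (μ : Measure Ω)
    (P : (n : ℕ) → ℝ≥0 → Kernel (Fin n → M) (Fin n → M))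
    (ψ : ℝ → ℝ → Ω → MeasMap M) : Prop where
  measurable : ∀ s t, s ≤ t → Measurable (ψ s t)
  regularity : ∀ s t, s ≤ t → ∀ (n : ℕ) (x : Fin n → M) (f : C₀(Fin n → M, ℝ)),
    ∫ ω, f (fun i => (ψ s t ω).1 (x i)) ∂μ = ∫ y, f y ∂(P n (t - s).toNNReal x)
  flow : ∃ J : ℝ≥0 → MeasMap M × M → M, (∀ t, Measurable (J t)) ∧
    (∀ s t, s ≤ t → ∀ x, ∀ᵐ ω ∂μ, J (t - s).toNNReal (ψ s t ω, x) = (ψ s t ω).1 x) ∧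
    (∀ s t u, s ≤ t → t ≤ u → ∀ x,
      ∀ᵐ ω ∂μ, (ψ s u ω).1 x = J (u - t).toNNReal (ψ t u ω, (ψ s t ω).1 x))
  refl : ∀ s x ω, (ψ s s ω).1 x = x
  indep : ∀ (n : ℕ) (t : Fin (n + 1) → ℝ), Monotone t →
    iIndepFun (fun i : Fin n => ψ (t i.castSucc) (t i.succ)) μ
  time_continuity : ∀ (f : C₀(M, ℝ)) (s t : ℝ), s ≤ t →
    Tendsto (fun p : ℝ × ℝ => ⨆ x : M, ∫ ω, (f ((ψ p.1 p.2 ω).1 x) - f ((ψ s t ω).1 x)) ^ 2 ∂μ)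
      (𝓝[{p | p.1 ≤ p.2}] (s, t)) (𝓝 0)
  space_continuity : ∀ (f : C₀(M, ℝ)) (x : M) (s t : ℝ), s ≤ t →
    Tendsto (fun y => ∫ ω, (f ((ψ s t ω).1 y) - f ((ψ s t ω).1 x)) ^ 2 ∂μ) (𝓝 x) (𝓝 0)
  space_infinity : ∀ (f : C₀(M, ℝ)) (s t : ℝ), s ≤ t →
    Tendsto (fun y => ∫ ω, f ((ψ s t ω).1 y) ^ 2 ∂μ) (cocompact M) (𝓝 0)

/-! ### Paths and skeletons -/

/-- The space of continuous paths `f : [s, ∞) → M`, `s ∈ ℝ`. Such a path is encoded by its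
starting time `start = s` and by its continuous extension `path` to `ℝ` that is constant on
`(-∞, s]`. -/
structure PathSpace (M : Type*) [TopologicalSpace M] where
  start : ℝ
  path : C(ℝ, M)
  path_of_le : ∀ t ≤ start, path t = path start

/-- Convergence of the starting times, and locally uniform convergence of the extended paths. -/
instance {M : Type*} [TopologicalSpace M] : TopologicalSpace (PathSpace M) :=
  TopologicalSpace.induced (fun f => (f.start, f.path)) inferInstance

instance {M : Type*} [TopologicalSpace M] : MeasurableSpace (PathSpace M) := borel _

instance {M : Type*} [TopologicalSpace M] : BorelSpace (PathSpace M) := ⟨rfl⟩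

/-- The restriction `f[s, ∞)` of (the extension of) a path. -/
def PathSpace.restrict {M : Type*} [TopologicalSpace M] (f : PathSpace M) (s : ℝ) :
    PathSpace M where
  start := s
  path := ⟨fun t => f.path (max s t), by fun_prop⟩
  path_of_le := fun t ht => by simp [max_eq_left ht]

/-- A skeleton: a coalescing sequence of paths with dense starting points, for which the paths
(restricted to `[s, ∞)`) passing through a compact set of space-time points `(s, y)` form a
relatively compact set. -/
structure IsSkeleton {M : Type*} [TopologicalSpace M] (φ : ℕ → PathSpace M) : Prop where
  coalescence : ∀ (s : ℝ) (m n : ℕ), (φ m).start ≤ s → (φ n).start ≤ s →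
    (φ m).path s = (φ n).path s → ∀ t, s ≤ t → (φ m).path t = (φ n).path t
  dense : DenseRange (fun n => ((φ n).start, (φ n).path (φ n).start))
  relCompact : ∀ L : Set (ℝ × M), IsCompact L →
    IsCompact (closure {g : PathSpace M | ∃ (n : ℕ) (s : ℝ),
      (φ n).start ≤ s ∧ (s, (φ n).path s) ∈ L ∧ g = (φ n).restrict s})

/-- `Φ` is a random sequence of paths such that `Φ n` starts from `x n` at time `s n` and is a
continuous modification of `t ↦ ψ (s n) t (x n)`. -/
structure IsContinuousModification {M : Type*} [TopologicalSpace M] [MeasurableSpace M]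
    {Ω : Type*} [MeasurableSpace Ω] (μ : Measure Ω) (ψ : ℝ → ℝ → Ω → MeasMap M)
    (s : ℕ → ℝ) (x : ℕ → M) (Φ : Ω → ℕ → PathSpace M) : Prop where
  measurable : Measurable Φ
  start_eq : ∀ ω n, (Φ ω n).start = s n
  initial : ∀ ω n, (Φ ω n).path (s n) = x n
  modification : ∀ (n : ℕ) (t : ℝ), s n ≤ t → ∀ᵐ ω ∂μ, (Φ ω n).path t = (ψ (s n) t ω).1 (x n)

/-- A subset of a topological space is locally finite if every point of the space has a
neighbourhood that contains only finitely many points of the set. -/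
def IsLocallyFiniteSet {M : Type*} [TopologicalSpace M] (S : Set M) : Prop :=
  ∀ x : M, ∃ U ∈ 𝓝 x, (U ∩ S).Finite

/-- The instantaneous coalescence property of a sequence of paths. -/
def HasICP {M : Type*} [TopologicalSpace M] (φ : ℕ → PathSpace M) : Prop :=
  ∀ s t : ℝ, s < t → IsLocallyFiniteSet {y : M | ∃ n, (φ n).start ≤ s ∧ (φ n).path t = y}

/-! ### Markov laws on path space and property `𝒫` -/

/-- The cylindrical (equivalently, for a separable metric `E`, the Borel) σ-field on
`C([0, ∞) : E)`. -/
instance {E : Type*} [TopologicalSpace E] [MeasurableSpace E] : MeasurableSpace C(ℝ≥0, E) :=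
  ⨆ t : ℝ≥0, MeasurableSpace.comap (fun w : C(ℝ≥0, E) => w t) inferInstance

/-- `Q` is the law on `C([0, ∞) : E)` under which the canonical process is a Markov process (for
its own filtration) with transition function `P`, started from `x`. These requirements determine
the finite-dimensional distributions of `Q`, hence `Q`. -/
structure IsMarkovLaw {E : Type*} [TopologicalSpace E] [MeasurableSpace E]
    (P : ℝ≥0 → Kernel E E) (x : E) (Q : Measure C(ℝ≥0, E)) : Prop where
  prob : IsProbabilityMeasure Q
  initial : ∀ᵐ w ∂Q, w 0 = x
  markov : ∀ (s h : ℝ≥0) (A : Set C(ℝ≥0, E)) (B : Set E),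
    MeasurableSet[⨆ r : Set.Iic s,
      MeasurableSpace.comap (fun w : C(ℝ≥0, E) => w r) inferInstance] A →
    MeasurableSet B →
      Q (A ∩ {w | w (s + h) ∈ B}) = ∫⁻ w in A, P h (w s) B ∂Q

/-- `σ = inf {t : (X_t, Y_t) ∉ K²}`, with `inf ∅ = ∞`. -/
def exitTime {M : Type*} [TopologicalSpace M] (K : Set M) (w : C(ℝ≥0, Fin 2 → M)) : ℝ≥0∞ :=
  ⨅ (t : ℝ≥0) (_ : ¬ (w t 0 ∈ K ∧ w t 1 ∈ K)), (t : ℝ≥0∞)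

/-- `τ = inf {t : X_t = Y_t}`, with `inf ∅ = ∞`. -/
def meetingTime {M : Type*} [TopologicalSpace M] (w : C(ℝ≥0, Fin 2 → M)) : ℝ≥0∞ :=
  ⨅ (t : ℝ≥0) (_ : w t 0 = w t 1), (t : ℝ≥0∞)

/-- Property `𝒫` of a set `K`, for the two-point transition function `P2`. -/
def PropertyP {M : Type*} [MetricSpace M] [MeasurableSpace M]
    (P2 : ℝ≥0 → Kernel (Fin 2 → M) (Fin 2 → M)) (K : Set M) : Prop :=
  ∃ α β κ p C : ℝ, 0 < α ∧ 0 < β ∧ 0 < κ ∧ 0 < p ∧ 0 < C ∧ 1 < α * κ ∧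
    (∀ ε : ℝ, 0 < ε → ∀ x ∈ K, ∀ y ∈ K, dist x y ≤ ε →
      ∃ Q : Measure C(ℝ≥0, Fin 2 → M), IsMarkovLaw P2 ![x, y] Q ∧
        Q.real {w | ENNReal.ofReal (β * ε ^ α) < min (exitTime K w) (meetingTime w)} ≤ 1 - p) ∧
    (∀ A : Set M, A ⊆ K → ∀ n : ℕ, 2 ≤ n → (n : ℕ∞) ≤ A.encard →
      ∃ x ∈ A, ∃ y ∈ A, x ≠ y ∧ dist x y ≤ C * (n : ℝ) ^ (-κ))

end

end StochFlow

/-! Fix a compact `K` with property `𝒫` and `r < t`, and count the distinct positions at time `v` of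
those among the first `N` paths that stay in `K` during `[r, v]`. Since paths coalesce, this count
never increases. While it equals `n ≥ 2`, (P2) provides two positions at distance at most `C n ^
(-κ)`, and by (P1) these two paths meet or leave `K` within time of order `n ^ (-ακ)` with
probability at least `p`; either event lowers the count. Allow about `n ^ δ` trials at level `n`,
with `0 < δ < ακ - 1`. Then the total time over all levels and the sum of the failure probabilities
`(1 - p) ^ (n ^ δ)` both converge, with bounds that do not depend on `N`. The probability that `m`
positions are left at time `t` is thus at most the tail of a convergent series, so a.s. only
finitely many are left (`IsContinuousModification.ae_finite`). Hypothesis (ii) confines all paths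
that end in `K k` to a single `K l` just before `t`, which gives the theorem.

The bound (P1) concerns laws on path space and has to be applied to trajectories of the flow
conditionally on their past. `IsMarkovProcess.measure_stay_le` does this through probabilities along
dyadic grids, which depend measurably on the starting point. The Markov property of the trajectories
comes from `IsContinuousModification.indep` and `IsContinuousModification.markov`;
`measure_manyAlive_step` turns the pair estimate into a decrease of the count. -/

namespace StochFlow

/-! ### Markov processes observed along a grid -/

/-- The probability that a Markov chain with transition kernel `P` stays in `B` during its first
`k` steps, as a function of the starting point. -/
noncomputable def stayProb {E : Type*} [MeasurableSpace E] (P : Kernel E E) (B : Set E) :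
    ℕ → E → ℝ≥0∞
  | 0 => B.indicator 1
  | k + 1 => B.indicator fun z => ∫⁻ y, stayProb P B k y ∂P z

lemma measurable_stayProb {E : Type*} [MeasurableSpace E] (P : Kernel E E) {B : Set E}
    (hB : MeasurableSet B) (k : ℕ) : Measurable (stayProb P B k) := by
  induction k with
  | zero => exact measurable_one.indicator hB
  | succ k ih => exact ih.lintegral_kernel.indicator hB

/-- The process `X` is Markov with respect to the filtration `F`, with transition function `P`. -/
structure IsMarkovProcess {Ω E : Type*} [mΩ : MeasurableSpace Ω] [MeasurableSpace E]
    (μ : Measure Ω) (P : ℝ≥0 → Kernel E E) (F : ℝ≥0 → MeasurableSpace Ω) (X : ℝ≥0 → Ω → E) :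
    Prop where
  mono : Monotone F
  le : ∀ s, F s ≤ mΩ
  adapted : ∀ s, Measurable[F s] (X s)
  markov : ∀ (s h : ℝ≥0) (A : Set Ω) (B : Set E), MeasurableSet[F s] A → MeasurableSet B →
    μ (A ∩ {ω | X (s + h) ω ∈ B}) = ∫⁻ ω in A, P h (X s ω) B ∂μ

namespace IsMarkovProcess

variable {Ω E : Type*} [mΩ : MeasurableSpace Ω] [MeasurableSpace E] {μ : Measure Ω}
  {P : ℝ≥0 → Kernel E E} {F : ℝ≥0 → MeasurableSpace Ω} {X : ℝ≥0 → Ω → E}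

lemma measurable (hX : IsMarkovProcess μ P F X) (s : ℝ≥0) : Measurable (X s) :=
  (hX.adapted s).mono (hX.le s) le_rfl

lemma setLIntegral_comp (hX : IsMarkovProcess μ P F X) (s h : ℝ≥0) {A : Set Ω}
    (hA : MeasurableSet[F s] A) {f : E → ℝ≥0∞} (hf : Measurable f) :
    ∫⁻ ω in A, f (X (s + h) ω) ∂μ = ∫⁻ ω in A, ∫⁻ y, f y ∂(P h (X s ω)) ∂μ := by
  have key : (μ.restrict A).map (X (s + h)) = ((μ.restrict A).map (X s)).bind (P h) := by
    ext B hB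
    rw [Measure.map_apply (hX.measurable _) hB,
      Measure.restrict_apply (hX.measurable _ hB),
      Measure.bind_apply hB (P h).measurable.aemeasurable,
      lintegral_map ((P h).measurable_coe hB) (hX.measurable _), ← hX.markov s h A B hA hB,
      inter_comm]
    rfl
  rw [← lintegral_map hf (hX.measurable _), key,
    Measure.lintegral_bind (P h).measurable.aemeasurable hf.aemeasurable,
    lintegral_map hf.lintegral_kernel (hX.measurable _)]

/-- The condition at time `s` is absorbed into the event `A` before the Markov property is used for
one step; this is why the induction runs over all `s` and `A`. -/
lemma measure_stay (hX : IsMarkovProcess μ P F X) (δ : ℝ≥0) {B : Set E} (hB : MeasurableSet B)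
    (k : ℕ) (s : ℝ≥0) {A : Set Ω} (hA : MeasurableSet[F s] A) :
    μ (A ∩ {ω | ∀ j ≤ k, X (s + j * δ) ω ∈ B}) =
      ∫⁻ ω in A, stayProb (P δ) B k (X s ω) ∂μ := by
  induction k generalizing s A with
  | zero =>
    have h1 : (fun ω => stayProb (P δ) B 0 (X s ω)) = (X s ⁻¹' B).indicator 1 := rfl
    rw [h1, lintegral_indicator_one (hX.measurable s hB),
      Measure.restrict_apply (hX.measurable s hB), inter_comm]
    congr 1
    ext ω
    simp
  | succ k ih =>
    have hXB : MeasurableSet[F s] (X s ⁻¹' B) := hX.adapted s hB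
    have h1 : (fun ω => stayProb (P δ) B (k + 1) (X s ω)) = (X s ⁻¹' B).indicator
      (fun ω => ∫⁻ y, stayProb (P δ) B k y ∂(P δ (X s ω))) := rfl
    have h2 : A ∩ {ω | ∀ j ≤ k + 1, X (s + j * δ) ω ∈ B} =
        (X s ⁻¹' B ∩ A) ∩ {ω | ∀ j ≤ k, X ((s + δ) + j * δ) ω ∈ B} := by
      ext ω
      have e : ∀ j : ℕ, s + δ + j * δ = s + ((j + 1 : ℕ) : ℝ≥0) * δ := by
        intro j; push_cast; ring
      simp only [e, mem_inter_iff, mem_ofPred_eq, mem_preimage]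
      constructor
      · rintro ⟨hA, h⟩
        exact ⟨⟨by simpa using h 0 (by omega), hA⟩, fun j hj => h (j + 1) (by omega)⟩
      · rintro ⟨⟨h0, hA⟩, h⟩
        refine ⟨hA, fun j hj => ?_⟩
        rcases j with _ | j
        · simpa using h0
        · exact h j (by omega)
    have hA' : MeasurableSet[F s] (X s ⁻¹' B ∩ A) := MeasurableSet.inter hXB hA
    rw [h2, ih (s + δ) (hX.mono (le_self_add) _ hA'), h1,
      setLIntegral_indicator (hX.measurable s hB),
      hX.setLIntegral_comp s δ hA' (measurable_stayProb _ hB k)]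

end IsMarkovProcess

lemma IsMarkovLaw.isMarkovProcess {E : Type*} [TopologicalSpace E] [MeasurableSpace E]
    {P : ℝ≥0 → Kernel E E} {x : E} {Q : Measure C(ℝ≥0, E)} (hQ : IsMarkovLaw P x Q) :
    IsMarkovProcess Q P (fun s => ⨆ r : Set.Iic s,
      MeasurableSpace.comap (fun w : C(ℝ≥0, E) => w r) inferInstance) (fun t w => w t) where
  mono := fun s t hst => iSup_le fun r =>
    le_iSup (fun r : Set.Iic t => MeasurableSpace.comap (fun w : C(ℝ≥0, E) => w r) inferInstance)
      ⟨r.1, r.2.trans hst⟩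
  le := fun s => iSup_le fun r => le_iSup (fun t : ℝ≥0 =>
    MeasurableSpace.comap (fun w : C(ℝ≥0, E) => w t) inferInstance) r.1
  adapted := fun s => by
    rw [measurable_iff_comap_le]
    exact le_iSup (fun r : Set.Iic s =>
      MeasurableSpace.comap (fun w : C(ℝ≥0, E) => w r) inferInstance) ⟨s, self_mem_Iic⟩
  markov := hQ.markov

/-- The times `j h / 2 ^ m`, `j ≤ 2 ^ m`, are dense in `[0, h]`. -/
lemma mem_of_forall_dyadic {E : Type*} [TopologicalSpace E] {B : Set E} (hB : IsClosed B)
    {h : ℝ≥0} {f : ℝ≥0 → E} (hf : Continuous f)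
    (hfB : ∀ m j : ℕ, j ≤ 2 ^ m → f (j * (h / 2 ^ m)) ∈ B) {t : ℝ≥0} (ht : t ≤ h) : f t ∈ B := by
  rcases eq_or_ne h 0 with rfl | h0
  · obtain rfl : t = 0 := le_antisymm ht zero_le
    simpa using hfB 0 0 (by simp)
  have h1 : Tendsto (fun m : ℕ => ((2 : ℝ) ^ m)) atTop atTop :=
    tendsto_pow_atTop_atTop_of_one_lt one_lt_two
  have h0' : (h : ℝ) ≠ 0 := by exact_mod_cast h0
  have h2 : Tendsto (fun m : ℕ => (⌊(t / h : ℝ) * 2 ^ m⌋₊ : ℝ≥0) * (h / 2 ^ m))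
      atTop (𝓝 t) := by
    rw [← NNReal.tendsto_coe]
    have h3 := ((tendsto_nat_floor_mul_div_atTop (R := ℝ) (a := (t / h : ℝ))
      (by positivity)).comp h1).mul_const (h : ℝ)
    rw [div_mul_cancel₀ _ h0'] at h3
    refine h3.congr fun m => ?_
    simp only [Function.comp]
    push_cast
    rw [div_mul_eq_mul_div, mul_div_assoc]
  refine hB.mem_of_tendsto ((hf.tendsto t).comp h2) (Eventually.of_forall fun m => hfB m _ ?_)
  have h4 : (t / h : ℝ) * 2 ^ m ≤ ((2 ^ m : ℕ) : ℝ) := by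
    push_cast
    exact mul_le_of_le_one_left (by positivity) (div_le_one_of_le₀ (by exact_mod_cast ht) h.2)
  exact (Nat.floor_mono h4).trans_eq (Nat.floor_natCast _)

/-- By continuity of the paths and closedness of `B`, the event on the right is the decreasing limit
of the events along dyadic grids. The approximants are measurable in `x`, which is not known of a
family of laws `Q`. -/
lemma IsMarkovLaw.tendsto_stayProb {E : Type*} [TopologicalSpace E] [MeasurableSpace E]
    [OpensMeasurableSpace E] {P : ℝ≥0 → Kernel E E} {x : E} {Q : Measure C(ℝ≥0, E)}
    (hQ : IsMarkovLaw P x Q) {B : Set E} (hB : IsClosed B) (h : ℝ≥0) :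
    Tendsto (fun m : ℕ => stayProb (P (h / 2 ^ m)) B (2 ^ m) x) atTop
      (𝓝 (Q {w | ∀ t ≤ h, w t ∈ B})) := by
  have := hQ.prob
  have hX := hQ.isMarkovProcess
  let W : ℕ → Set C(ℝ≥0, E) := fun m => {w | ∀ j : ℕ, j ≤ 2 ^ m → w (j * (h / 2 ^ m)) ∈ B}
  have hW : ∀ m, Q (W m) = stayProb (P (h / 2 ^ m)) B (2 ^ m) x := by
    intro m
    have h1 := hX.measure_stay (h / 2 ^ m) hB.measurableSet (2 ^ m) 0 MeasurableSet.univ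
    simp only [univ_inter, zero_add, Measure.restrict_univ] at h1
    rw [h1, lintegral_congr_ae (g := fun _ => stayProb (P (h / 2 ^ m)) B (2 ^ m) x)]
    · simp
    · filter_upwards [hQ.initial] with w hw
      rw [hw]
  have hWm : ∀ m, MeasurableSet (W m) := by
    intro m
    simp only [W, ofPred_forall]
    exact .iInter fun j => .iInter fun _ => hX.measurable _ hB.measurableSet
  have hanti : Antitone W := by
    refine antitone_nat_of_succ_le fun m w hw j hj => ?_
    have := hw (2 * j) (by rw [pow_succ]; omega)
    convert this using 2
    push_cast
    rw [pow_succ]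
    field_simp
  have hlim : {w : C(ℝ≥0, E) | ∀ t ≤ h, w t ∈ B} = ⋂ m, W m := by
    ext w
    simp only [mem_ofPred_eq, mem_iInter, W]
    refine ⟨fun hw m j hj => hw _ ?_, fun hw t ht => mem_of_forall_dyadic hB w.continuous hw ht⟩
    rw [mul_div_left_comm]
    refine mul_le_of_le_one_right zero_le (div_le_one_of_le₀ ?_ zero_le)
    exact_mod_cast hj
  rw [hlim]
  simp_rw [← hW]
  exact tendsto_measure_iInter_atTop (fun m => (hWm m).nullMeasurableSet) hanti
    ⟨0, measure_ne_top _ _⟩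

lemma stayProb_le_one {E : Type*} [MeasurableSpace E] (P : Kernel E E) [IsMarkovKernel P]
    (B : Set E) (k : ℕ) (x : E) : stayProb P B k x ≤ 1 := by
  induction k generalizing x with
  | zero => exact indicator_le_self' (by simp) x
  | succ k ih =>
    refine (indicator_le_self' (by simp) x).trans ?_
    calc ∫⁻ y, stayProb P B k y ∂P x ≤ ∫⁻ _, 1 ∂P x := lintegral_mono ih
      _ = 1 := by simp

/-- A bound for the path laws started from points of `G` carries over to a Markov process that is
in `G` at time `0`. -/
lemma IsMarkovProcess.measure_stay_le {Ω E : Type*} [mΩ : MeasurableSpace Ω] [TopologicalSpace E]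
    [MeasurableSpace E] [OpensMeasurableSpace E] {μ : Measure Ω} [IsFiniteMeasure μ]
    {P : ℝ≥0 → Kernel E E} [∀ t, IsMarkovKernel (P t)]
    {F : ℝ≥0 → MeasurableSpace Ω} {X : ℝ≥0 → Ω → E} (hX : IsMarkovProcess μ P F X)
    {B : Set E} (hB : IsClosed B) (h : ℝ≥0) {G : Set E} {c : ℝ≥0∞}
    (hG : ∀ z ∈ G, ∃ Q : Measure C(ℝ≥0, E), IsMarkovLaw P z Q ∧ Q {w | ∀ t ≤ h, w t ∈ B} ≤ c)
    {A : Set Ω} (hA : MeasurableSet[F 0] A) (hAG : ∀ ω ∈ A, X 0 ω ∈ G) :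
    μ (A ∩ {ω | ∀ t ≤ h, X t ω ∈ B}) ≤ c * μ A := by
  classical
  choose! Q hQ hQc using hG
  have hAm : MeasurableSet A := hX.le 0 _ hA
  -- `Q` is a mere choice, possibly not measurable in `z`; dominated convergence needs measurability
  -- of the approximants only.
  have hlim : Tendsto (fun m : ℕ => ∫⁻ ω in A, stayProb (P (h / 2 ^ m)) B (2 ^ m) (X 0 ω) ∂μ) atTop
      (𝓝 (∫⁻ ω in A, Q (X 0 ω) {w | ∀ t ≤ h, w t ∈ B} ∂μ)) := by
    refine tendsto_lintegral_of_dominated_convergence (fun _ => 1)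
      (fun m => (measurable_stayProb _ hB.measurableSet _).comp (hX.measurable 0))
      (fun m => Eventually.of_forall fun ω => stayProb_le_one _ _ _ _) (by simp) ?_
    refine (ae_restrict_iff' hAm).2 (Eventually.of_forall fun ω hω => ?_)
    exact (hQ _ (hAG ω hω)).tendsto_stayProb hB h
  have h1 : μ (A ∩ {ω | ∀ t ≤ h, X t ω ∈ B}) ≤
      ∫⁻ ω in A, Q (X 0 ω) {w | ∀ t ≤ h, w t ∈ B} ∂μ := by
    refine ge_of_tendsto' hlim fun m => ?_
    rw [← hX.measure_stay (h / 2 ^ m) hB.measurableSet (2 ^ m) 0 hA]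
    refine measure_mono (inter_subset_inter_right _ fun ω hω j hj => hω _ ?_)
    rw [zero_add, mul_div_left_comm]
    refine mul_le_of_le_one_right zero_le (div_le_one_of_le₀ ?_ zero_le)
    exact_mod_cast hj
  refine h1.trans ?_
  calc ∫⁻ ω in A, Q (X 0 ω) {w | ∀ t ≤ h, w t ∈ B} ∂μ ≤ ∫⁻ _ in A, c ∂μ :=
        setLIntegral_mono' hAm fun ω hω => hQc _ (hAG ω hω)
    _ = c * μ A := by simp

/-! ### The Markov property of the trajectories of a stochastic flow -/

lemma PathSpace.continuous_eval {M : Type*} [TopologicalSpace M] (t : ℝ) :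
    Continuous (fun f : PathSpace M => f.path t) := by
  have h : Continuous (fun f : PathSpace M => (f.start, f.path)) := continuous_induced_dom
  exact (continuous_eval_const t).comp h.snd

/-- The σ-field generated by the trajectories up to time `v`. -/
@[reducible] def pathFiltration {M : Type*} [TopologicalSpace M] [MeasurableSpace M] {Ω : Type*}
    (s : ℕ → ℝ) (Φ : Ω → ℕ → PathSpace M) (v : ℝ) : MeasurableSpace Ω :=
  ⨆ e : {e : ℕ × ℝ // s e.1 ≤ e.2 ∧ e.2 ≤ v},
    MeasurableSpace.comap (fun ω => (Φ ω e.1.1).path e.1.2) inferInstance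

lemma pathFiltration_mono {M : Type*} [TopologicalSpace M] [MeasurableSpace M] {Ω : Type*}
    (s : ℕ → ℝ) (Φ : Ω → ℕ → PathSpace M) : Monotone (pathFiltration s Φ) := fun _ w hvw =>
  iSup_le fun e => le_iSup
    (fun e : {e : ℕ × ℝ // s e.1 ≤ e.2 ∧ e.2 ≤ w} =>
      MeasurableSpace.comap (fun ω => (Φ ω e.1.1).path e.1.2) inferInstance)
    ⟨e.1, e.2.1, e.2.2.trans hvw⟩

lemma measurable_path_pathFiltration {M : Type*} [TopologicalSpace M] [MeasurableSpace M]
    {Ω : Type*} (s : ℕ → ℝ) (Φ : Ω → ℕ → PathSpace M) {v q : ℝ} {i : ℕ} (h1 : s i ≤ q)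
    (h2 : q ≤ v) : Measurable[pathFiltration s Φ v] (fun ω => (Φ ω i).path q) := by
  rw [measurable_iff_comap_le]
  exact le_iSup (fun e : {e : ℕ × ℝ // s e.1 ≤ e.2 ∧ e.2 ≤ v} =>
      MeasurableSpace.comap (fun ω => (Φ ω e.1.1).path e.1.2) inferInstance) ⟨(i, q), h1, h2⟩

/-- Finitely many times up to `v` can be sorted into a sequence that continues with `v`, `w`. -/
lemma exists_monotone_seq (T : Finset ℝ) {v w : ℝ} (hT : ∀ u ∈ T, u ≤ v) (hvw : v ≤ w) :
    ∃ (t : ℕ → ℝ) (n : ℕ), Monotone t ∧ t n = v ∧ t (n + 1) = w ∧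
      ∀ u ∈ T, ∃ a ≤ n, t a = u := by
  induction T using Finset.induction_on_max generalizing v w with
  | empty =>
    refine ⟨fun k => if k = 0 then v else w, 0, monotone_nat_of_le_succ fun k => ?_, by simp,
      by simp, by simp⟩
    rcases k with _ | k <;> simp [hvw]
  | insert a T ha ih =>
    obtain ⟨t, n, htm, htn, htn', hTt⟩ := ih (fun u hu => (ha u hu).le)
      (hT a (Finset.mem_insert_self _ _))
    refine ⟨fun k => if k ≤ n + 1 then t k else w, n + 1, monotone_nat_of_le_succ fun k => ?_,
      by simp [htn'], by simp, ?_⟩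
    · by_cases h1 : k + 1 ≤ n + 1
      · simp only [h1, if_true, show k ≤ n + 1 by omega]
        exact htm (Nat.le_succ k)
      · simp only [h1, if_false]
        split_ifs with h2
        · exact (htm h2).trans (htn'.trans_le hvw)
        · exact le_rfl
    · intro u hu
      rcases Finset.mem_insert.1 hu with rfl | hu
      · exact ⟨n, by omega, by simp [htn]⟩
      · obtain ⟨b, hb, rfl⟩ := hTt u hu
        exact ⟨b, by omega, by simp [show b ≤ n + 1 by omega]⟩

section

variable {M : Type*} [MetricSpace M] [MeasurableSpace M] {Ω : Type*} [MeasurableSpace Ω]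
    {μ : Measure Ω} {P : (n : ℕ) → ℝ≥0 → Kernel (Fin n → M) (Fin n → M)}
    {ψ : ℝ → ℝ → Ω → MeasMap M} {s : ℕ → ℝ} {x : ℕ → M} {Φ : Ω → ℕ → PathSpace M}

lemma measurable_eval_measMap {M : Type*} [MeasurableSpace M] (x : M) :
    Measurable (fun f : MeasMap M => f.1 x) :=
  (measurable_pi_apply x).comp measurable_subtype_coe

/-- The motion of a point is a function of the increments of the flow. -/
lemma IsStochasticFlow.exists_eq_increments (hψ : IsStochasticFlow μ P ψ) {t : ℕ → ℝ}
    (ht : Monotone t) (n : ℕ) {a b : ℕ} (hab : a ≤ b) (hbn : b ≤ n) (x : M) :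
    ∃ G : (Fin n → MeasMap M) → M, Measurable G ∧
      ∀ᵐ ω ∂μ, (ψ (t a) (t b) ω).1 x = G (fun i => ψ (t i) (t (i + 1)) ω) := by
  obtain ⟨J, hJ, -, hflow⟩ := hψ.flow
  induction b, hab using Nat.le_induction with
  | base => exact ⟨fun _ => x, measurable_const, Eventually.of_forall fun ω => hψ.refl _ _ _⟩
  | succ b hab ih =>
    obtain ⟨G, hG, hGe⟩ := ih (by omega)
    -- Evaluation `(f, y) ↦ f y` need not be jointly measurable for the cylindrical σ-field; `J` is
    -- its measurable substitute.
    refine ⟨fun f => J (t (b + 1) - t b).toNNReal (f ⟨b, by omega⟩, G f),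
      (hJ _).comp ((measurable_pi_apply _).prodMk hG), ?_⟩
    filter_upwards [hGe, hflow _ _ _ (ht hab) (ht (Nat.le_succ b)) x] with ω h1 h2
    rw [h2, h1]

variable [BorelSpace M]

lemma IsContinuousModification.measurable_path (hΦ : IsContinuousModification μ ψ s x Φ)
    (i : ℕ) (t : ℝ) : Measurable (fun ω => (Φ ω i).path t) :=
  (PathSpace.continuous_eval t).measurable.comp ((measurable_pi_apply i).comp hΦ.measurable)

lemma IsContinuousModification.pathFiltration_le (hΦ : IsContinuousModification μ ψ s x Φ)
    (v : ℝ) : pathFiltration s Φ v ≤ ‹MeasurableSpace Ω› :=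
  iSup_le fun e => (hΦ.measurable_path e.1.1 e.1.2).comap_le

variable [IsProbabilityMeasure μ]

/-- The trajectories up to time `v` are independent of the flow after time `v`. -/
lemma IsContinuousModification.indep (hψ : IsStochasticFlow μ P ψ)
    (hΦ : IsContinuousModification μ ψ s x Φ) {v w : ℝ} (hvw : v ≤ w) :
    Indep (pathFiltration s Φ v) (MeasurableSpace.comap (ψ v w) inferInstance) μ := by
  classical
  -- Finitely many observations suffice. Their starting and observation times fit into one partition
  -- ending with `v`, `w`, and the increments over its intervals are independent.
  rw [pathFiltration, iSup_eq_iSup_finset]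
  refine indep_iSup_of_directed_le (fun T => ?_)
    (fun T => iSup₂_le fun e _ => (hΦ.measurable_path e.1.1 e.1.2).comap_le)
    (hψ.measurable v w hvw).comap_le
    (Monotone.directed_le fun T T' h => biSup_mono fun _ he => Finset.mem_of_subset h he)
  obtain ⟨t, n, htm, htn, htn', hT⟩ := exists_monotone_seq
    (T.image (fun e => s e.1.1) ∪ T.image (fun e => e.1.2)) (v := v) (w := w) (by
      intro u hu
      simp only [Finset.mem_union, Finset.mem_image] at hu
      rcases hu with ⟨e, -, rfl⟩ | ⟨e, -, rfl⟩
      · exact e.2.1.trans e.2.2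
      · exact e.2.2) hvw
  have hG : ∀ e : T, ∃ G : (Fin n → MeasMap M) → M, Measurable G ∧
      ∀ᵐ ω ∂μ, (Φ ω e.1.1.1).path e.1.1.2 = G (fun i => ψ (t i) (t (i + 1)) ω) := by
    intro e
    obtain ⟨a, -, ha⟩ := hT (s e.1.1.1) (Finset.mem_union_left _ (Finset.mem_image_of_mem _ e.2))
    obtain ⟨b, hb, hb'⟩ := hT e.1.1.2
      (Finset.mem_union_right _ (Finset.mem_image_of_mem (fun e => e.1.2) e.2))
    rcases le_or_gt a b with hab | hab
    · obtain ⟨G, hG, hGe⟩ := hψ.exists_eq_increments htm n hab hb (x e.1.1.1)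
      refine ⟨G, hG, ?_⟩
      filter_upwards [hGe, hΦ.modification e.1.1.1 e.1.1.2 e.1.2.1] with ω h1 h2
      rw [h2, ← h1, ha, hb']
    -- The indices may come in the wrong order only if both times coincide, and then the observed
    -- position is the deterministic starting point.
    · have h1 : s e.1.1.1 = e.1.1.2 :=
        le_antisymm e.1.2.1 (by rw [← ha, ← hb']; exact htm hab.le)
      exact ⟨fun _ => x e.1.1.1, measurable_const, Eventually.of_forall fun ω => by
        rw [← h1, hΦ.initial]⟩
  choose G hGm hGe using hG
  have hind : IndepFun (fun ω (i : Fin n) => ψ (t i) (t (i + 1)) ω) (ψ v w) μ := by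
    have h1 := hψ.indep (n + 1) (fun i => t i) (fun i j hij => htm hij)
    have h2 := h1.indepFun_finset ({Fin.last n}ᶜ) {Fin.last n} disjoint_compl_left
      (fun i => hψ.measurable _ _ (htm (by simp)))
    have h3 : Measurable (fun (f : ({Fin.last n}ᶜ : Finset (Fin (n + 1))) → MeasMap M)
        (i : Fin n) => f ⟨i.castSucc, by simp [Fin.castSucc_ne_last]⟩) :=
      measurable_pi_lambda _ fun i => measurable_pi_apply _
    have h4 : Measurable (fun f : ({Fin.last n} : Finset (Fin (n + 1))) → MeasMap M =>
        f ⟨Fin.last n, Finset.mem_singleton_self _⟩) := measurable_pi_apply _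
    have h5 := h2.comp h3 h4
    have h6 : ψ v w = ψ (t n) (t (n + 1)) := by rw [htn, htn']
    rw [h6]
    exact h5
  have hind2 : IndepFun (fun ω (e : T) => (Φ ω e.1.1.1).path e.1.1.2) (ψ v w) μ := by
    have h1 := hind.comp (φ := fun f (e : T) => G e f) (measurable_pi_lambda _ fun e => hGm e)
      measurable_id
    refine IndepFun.congr h1 ?_ (Eventually.of_forall fun ω => rfl)
    filter_upwards [ae_all_iff.2 hGe] with ω hω
    ext e
    exact (hω e).symm
  refine indep_of_indep_of_le_left ((IndepFun_iff_Indep _ _ _).1 hind2) (iSup₂_le fun e he => ?_)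
  rintro _ ⟨B, hB, rfl⟩
  exact ⟨_, measurable_pi_apply (⟨e, he⟩ : T) hB, rfl⟩

variable [LocallyCompactSpace M] [TopologicalSpace.SeparableSpace M]

/-- The law of the `n`-point motion of a stochastic flow. -/
lemma IsStochasticFlow.map_eq (hP : ∀ n, IsFeller (P n)) (hψ : IsStochasticFlow μ P ψ)
    {v w : ℝ} (hvw : v ≤ w) {n : ℕ} (z : Fin n → M) :
    μ.map (fun ω i => (ψ v w ω).1 (z i)) = P n (w - v).toNNReal z := by
  have : SecondCountableTopology M := UniformSpace.secondCountable_of_separable M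
  have := (hP n).markov (w - v).toNNReal
  have hm : Measurable (fun ω i => (ψ v w ω).1 (z i)) :=
    measurable_pi_lambda _ fun i => (measurable_eval_measMap _).comp (hψ.measurable v w hvw)
  have := Measure.isProbabilityMeasure_map (μ := μ) hm.aemeasurable
  refine Measure.ext_of_integral_eq_on_compactlySupported fun f => ?_
  rw [integral_map hm.aemeasurable (map_continuous f).measurable.aestronglyMeasurable]
  exact hψ.regularity v w hvw n z
    ⟨f.toContinuousMap, f.hasCompactSupport.is_zero_at_infty⟩

/-- The `n`-point Markov property of the trajectories. -/
lemma IsContinuousModification.markov (hP : ∀ n, IsFeller (P n)) (hψ : IsStochasticFlow μ P ψ)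
    (hΦ : IsContinuousModification μ ψ s x Φ) {v w : ℝ} (hvw : v ≤ w) {n : ℕ} (i : Fin n → ℕ)
    (hi : ∀ k, s (i k) ≤ v) {A : Set Ω} (hA : MeasurableSet[pathFiltration s Φ v] A)
    {B : Set (Fin n → M)} (hB : MeasurableSet B) :
    μ (A ∩ {ω | (fun k => (Φ ω (i k)).path w) ∈ B}) =
      ∫⁻ ω in A, P n (w - v).toNNReal (fun k => (Φ ω (i k)).path v) B ∂μ := by
  have : SecondCountableTopology M := UniformSpace.secondCountable_of_separable M
  have := (hP n).markov (w - v).toNNReal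
  obtain ⟨J, hJ, hJ', hflow⟩ := hψ.flow
  let X : Ω → Fin n → M := fun ω k => (Φ ω (i k)).path v
  let S : (Fin n → M) × MeasMap M → Fin n → M := fun q k => J (w - v).toNNReal (q.2, q.1 k)
  have hS : Measurable S := measurable_pi_lambda _ fun k =>
    (hJ _).comp (measurable_snd.prodMk ((measurable_pi_apply k).comp measurable_fst))
  have hXm : Measurable X := measurable_pi_lambda _ fun k => hΦ.measurable_path _ _
  have hXF : Measurable[pathFiltration s Φ v] X :=
    @measurable_pi_lambda _ _ _ (pathFiltration s Φ v) _ _ fun k =>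
      measurable_path_pathFiltration s Φ (hi k) le_rfl
  have hYm := hψ.measurable v w hvw
  have := Measure.isProbabilityMeasure_map (μ := μ) hYm.aemeasurable
  -- On `A`, the present positions are independent of the increment `ψ v w`. By Fubini it is then
  -- enough to know the law of `S (z, ψ v w)` for fixed `z`, and this is the `n`-point kernel.
  have hprod : ((μ.restrict A).map X).prod (μ.map (ψ v w)) =
      (μ.restrict A).map (fun ω => (X ω, ψ v w ω)) := by
    refine Measure.prod_eq fun B₁ B₂ hB₁ hB₂ => ?_
    rw [Measure.map_apply (hXm.prodMk hYm) (hB₁.prod hB₂), Measure.map_apply hXm hB₁,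
      Measure.map_apply hYm hB₂, Measure.restrict_apply (hXm.prodMk hYm (hB₁.prod hB₂)),
      Measure.restrict_apply (hXm hB₁)]
    have hind := (Indep_iff _ _ μ).1 (hΦ.indep hψ hvw) (X ⁻¹' B₁ ∩ A) (ψ v w ⁻¹' B₂)
      (MeasurableSet.inter (hXF hB₁) hA) ⟨B₂, hB₂, rfl⟩
    rw [← hind]
    congr 1
    ext ω
    simp only [mem_inter_iff, mem_preimage, mem_prod]
    tauto
  have hae : ∀ᵐ ω ∂μ, (fun k => (Φ ω (i k)).path w) = S (X ω, ψ v w ω) := by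
    have h1 : ∀ k, ∀ᵐ ω ∂μ, (Φ ω (i k)).path w = S (X ω, ψ v w ω) k := by
      intro k
      filter_upwards [hflow _ _ _ (hi k) hvw (x (i k)), hΦ.modification (i k) w ((hi k).trans hvw),
        hΦ.modification (i k) v (hi k)] with ω h1 h2 h3
      simp only [S, X, h2, h1, h3]
    filter_upwards [ae_all_iff.2 h1] with ω hω
    exact funext hω
  have hlaw : ∀ z, (μ.map (ψ v w)) (Prod.mk z ⁻¹' (S ⁻¹' B)) = P n (w - v).toNNReal z B := by
    intro z
    have hm : Measurable (fun ω k => (ψ v w ω).1 (z k)) :=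
      measurable_pi_lambda _ fun k => (measurable_eval_measMap _).comp hYm
    rw [Measure.map_apply hYm (measurable_prodMk_left (hS hB)), ← hψ.map_eq hP hvw z,
      Measure.map_apply hm hB]
    refine measure_congr (eventuallyEq_set.2 ?_)
    filter_upwards [ae_all_iff.2 fun k => hJ' v w hvw (z k)] with ω hω
    change S (z, ψ v w ω) ∈ B ↔ _ ∈ B
    rw [show S (z, ψ v w ω) = fun k => (ψ v w ω).1 (z k) from funext hω]
  have hset : μ (A ∩ {ω | (fun k => (Φ ω (i k)).path w) ∈ B}) =
      ((μ.restrict A).map (fun ω => (X ω, ψ v w ω))) (S ⁻¹' B) := by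
    rw [Measure.map_apply (hXm.prodMk hYm) (hS hB),
      Measure.restrict_apply ((hXm.prodMk hYm) (hS hB)), inter_comm]
    refine measure_congr (eventuallyEq_set.2 ?_)
    filter_upwards [hae] with ω hω
    simp only [mem_inter_iff, mem_ofPred_eq, mem_preimage, hω]
  rw [hset, ← hprod, Measure.prod_apply (hS hB)]
  simp_rw [hlaw]
  rw [lintegral_map ((P n _).measurable_coe hB) hXm]

end

/-! ### Pairs of trajectories -/

/-- Two paths that neither leave `K` nor meet during the time interval `[v, w]`. -/
def PairSurvives {M : Type*} [TopologicalSpace M] (K : Set M) (v w : ℝ) (f g : PathSpace M) :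
    Prop :=
  ∀ q ∈ Icc v w, f.path q ∈ K ∧ g.path q ∈ K ∧ f.path q ≠ g.path q

section

variable {M : Type*} [MetricSpace M] [LocallyCompactSpace M] [TopologicalSpace.SeparableSpace M]
    [MeasurableSpace M] [BorelSpace M] {Ω : Type*} [MeasurableSpace Ω] {μ : Measure Ω}
    [IsProbabilityMeasure μ]
    {P : (n : ℕ) → ℝ≥0 → Kernel (Fin n → M) (Fin n → M)}
    {ψ : ℝ → ℝ → Ω → MeasMap M} {s : ℕ → ℝ} {x : ℕ → M} {Φ : Ω → ℕ → PathSpace M}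

lemma IsContinuousModification.isMarkovProcess (hP : ∀ n, IsFeller (P n))
    (hψ : IsStochasticFlow μ P ψ) (hΦ : IsContinuousModification μ ψ s x Φ) {v : ℝ} {n : ℕ}
    (i : Fin n → ℕ) (hi : ∀ k, s (i k) ≤ v) :
    IsMarkovProcess μ (P n) (fun t => pathFiltration s Φ (v + t))
      (fun t ω k => (Φ ω (i k)).path (v + t)) where
  mono := fun t u htu => pathFiltration_mono s Φ (by gcongr)
  le := fun t => hΦ.pathFiltration_le _
  adapted := fun t => @measurable_pi_lambda _ _ _ (pathFiltration s Φ (v + t)) _ _ fun k =>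
    measurable_path_pathFiltration s Φ ((hi k).trans (by simp)) le_rfl
  markov := fun t h A B hA hB => by
    have h1 := hΦ.markov hP hψ (v := v + t) (w := v + (t + h : ℝ≥0)) (by simp) i
      (fun k => (hi k).trans (by simp)) hA hB
    rw [h1]
    have h2 : (v + ((t + h : ℝ≥0) : ℝ) - (v + t)).toNNReal = h := by
      rw [NNReal.coe_add, show v + ((t : ℝ) + h) - (v + t) = h by ring, Real.toNNReal_coe]
    rw [h2]

omit [LocallyCompactSpace M] [TopologicalSpace.SeparableSpace M] [MeasurableSpace M]
  [BorelSpace M] in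
-- Survival up to `h'` only bounds the two infima below by `h'`; the margin `h < h'` yields the
-- strict inequality that occurs in (P1).
lemma lt_min_exitTime_meetingTime {K : Set M} {h h' : ℝ≥0} (hh : h < h')
    {w : C(ℝ≥0, Fin 2 → M)} (hw : ∀ t ≤ h', w t 0 ∈ K ∧ w t 1 ∈ K ∧ w t 0 ≠ w t 1) :
    (h : ℝ≥0∞) < min (exitTime K w) (meetingTime w) := by
  refine lt_of_lt_of_le (ENNReal.coe_lt_coe.2 hh) (le_min ?_ ?_)
  · refine le_iInf₂ fun t ht => ENNReal.coe_le_coe.2 ?_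
    by_contra! hlt
    exact ht ⟨(hw t hlt.le).1, (hw t hlt.le).2.1⟩
  · refine le_iInf₂ fun t ht => ENNReal.coe_le_coe.2 ?_
    by_contra! hlt
    exact (hw t hlt.le).2.2 ht

/-- Not having met is not a closed condition, so it is exhausted by the closed sets `B k`, where the
distance is at least `1 / (k + 1)`: the distance of two surviving paths has a positive minimum on
the compact time interval. -/
lemma IsContinuousModification.measure_pairSurvives_le (hP : ∀ n, IsFeller (P n))
    (hψ : IsStochasticFlow μ P ψ) (hΦ : IsContinuousModification μ ψ s x Φ)
    {K : Set M} (hK : IsClosed K) {h h' : ℝ≥0} (hh : h < h') {ε : ℝ} {c : ℝ≥0∞}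
    (hQ : ∀ y ∈ K, ∀ z ∈ K, dist y z ≤ ε → ∃ Q : Measure C(ℝ≥0, Fin 2 → M),
      IsMarkovLaw (P 2) ![y, z] Q ∧ Q {w | (h : ℝ≥0∞) < min (exitTime K w) (meetingTime w)} ≤ c)
    {v : ℝ} {i j : ℕ} (hi : s i ≤ v) (hj : s j ≤ v) {A : Set Ω}
    (hA : MeasurableSet[pathFiltration s Φ v] A)
    (hAK : ∀ ω ∈ A, (Φ ω i).path v ∈ K ∧ (Φ ω j).path v ∈ K ∧
      dist ((Φ ω i).path v) ((Φ ω j).path v) ≤ ε) :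
    μ (A ∩ {ω | PairSurvives K v (v + h') (Φ ω i) (Φ ω j)}) ≤ c * μ A := by
  have : SecondCountableTopology M := UniformSpace.secondCountable_of_separable M
  have : ∀ t, IsMarkovKernel (P 2 t) := (hP 2).markov
  let B : ℕ → Set (Fin 2 → M) := fun k =>
    {z | z 0 ∈ K ∧ z 1 ∈ K ∧ 1 / ((k : ℝ) + 1) ≤ dist (z 0) (z 1)}
  have hB : ∀ k, IsClosed (B k) := fun k =>
    (hK.preimage (continuous_apply 0)).inter ((hK.preimage (continuous_apply 1)).inter
      (isClosed_le continuous_const ((continuous_apply 0).dist (continuous_apply 1))))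
  have hBpos : ∀ k, ∀ z ∈ B k, z 0 ≠ z 1 := by
    intro k z hz heq
    have := hz.2.2
    rw [heq, dist_self] at this
    exact absurd this (not_le.2 (by positivity))
  let X : ℝ≥0 → Ω → Fin 2 → M := fun t ω k => (Φ ω (![i, j] k)).path (v + t)
  have hX : IsMarkovProcess μ (P 2) (fun t => pathFiltration s Φ (v + t)) X :=
    hΦ.isMarkovProcess hP hψ ![i, j] (by intro k; fin_cases k <;> simpa)
  let E : ℕ → Set Ω := fun k => A ∩ {ω | ∀ t ≤ h', X t ω ∈ B k}
  have hE : ∀ k, μ (E k) ≤ c * μ A := by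
    intro k
    refine hX.measure_stay_le (hB k) h'
      (G := {z | z 0 ∈ K ∧ z 1 ∈ K ∧ dist (z 0) (z 1) ≤ ε}) ?_ ?_ ?_
    · intro z hz
      obtain ⟨Q, hQ, hQc⟩ := hQ _ hz.1 _ hz.2.1 hz.2.2
      have hz' : ![z 0, z 1] = z := by ext k; fin_cases k <;> rfl
      refine ⟨Q, hz' ▸ hQ, (measure_mono fun w hw => ?_).trans hQc⟩
      exact lt_min_exitTime_meetingTime hh fun t ht =>
        ⟨(hw t ht).1, (hw t ht).2.1, hBpos k _ (hw t ht)⟩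
    · rwa [NNReal.coe_zero, add_zero]
    · intro ω hω
      simpa [X] using hAK ω hω
  have hEmono : Monotone E := by
    intro k l hkl ω hω
    refine ⟨hω.1, fun t ht => ⟨(hω.2 t ht).1, (hω.2 t ht).2.1, le_trans ?_ (hω.2 t ht).2.2⟩⟩
    exact Nat.one_div_le_one_div hkl
  have hsub : A ∩ {ω | PairSurvives K v (v + h') (Φ ω i) (Φ ω j)} ⊆ ⋃ k, E k := by
    rintro ω ⟨hωA, hω⟩
    obtain ⟨q, hq, hqmin⟩ := (isCompact_Icc (a := v) (b := v + h')).exists_isMinOn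
      (nonempty_Icc.2 (by simp)) (f := fun q => dist ((Φ ω i).path q) ((Φ ω j).path q))
      (by fun_prop)
    obtain ⟨k, hk⟩ := exists_nat_one_div_lt (dist_pos.2 (hω q hq).2.2)
    refine mem_iUnion.2 ⟨k, hωA, fun t ht => ?_⟩
    have ht' : v + (t : ℝ) ∈ Icc v (v + h') := ⟨by simp, by gcongr⟩
    exact ⟨(hω _ ht').1, (hω _ ht').2.1, hk.le.trans (hqmin ht')⟩
  calc _ ≤ μ (⋃ k, E k) := measure_mono hsub
    _ = ⨆ k, μ (E k) := hEmono.measure_iUnion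
    _ ≤ c * μ A := iSup_le hE

end

/-! ### Families of surviving trajectories -/

/-- The paths `φ i`, `i ∈ J`, start before time `r`, stay in `K` during `[r, v]` and are at
distinct positions at time `v`. -/
structure AliveFamily {M : Type*} [TopologicalSpace M] (s : ℕ → ℝ) (K : Set M) (r v : ℝ)
    (φ : ℕ → PathSpace M) (J : Finset ℕ) : Prop where
  start_le : ∀ i ∈ J, s i ≤ r
  mem : ∀ i ∈ J, ∀ q ∈ Icc r v, (φ i).path q ∈ K
  injOn : (J : Set ℕ).InjOn (fun i => (φ i).path v)

/-- Among the first `N` paths that stay in `K` during `[r, v]`, at least `n` are at distinct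
positions at time `v`. -/
def ManyAlive {M : Type*} [TopologicalSpace M] (s : ℕ → ℝ) (K : Set M) (N : ℕ) (r v : ℝ) (n : ℕ)
    (φ : ℕ → PathSpace M) : Prop :=
  ∃ J ⊆ Finset.range N, J.card = n ∧ AliveFamily s K r v φ J

/-- Paths that coincide from their first meeting on. -/
def Coalescing {M : Type*} [TopologicalSpace M] (s : ℕ → ℝ) (φ : ℕ → PathSpace M) : Prop :=
  ∀ (q : ℝ) (m n : ℕ), s m ≤ q → s n ≤ q → (φ m).path q = (φ n).path q →
    ∀ t, q ≤ t → (φ m).path t = (φ n).path t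

section

variable {M : Type*} [TopologicalSpace M] {s : ℕ → ℝ} {K : Set M} {N n : ℕ} {r v w : ℝ}
  {φ : ℕ → PathSpace M}

/-- Paths that agree at `v` still agree at `w`, so the number of distinct survivors cannot grow with
time. -/
lemma AliveFamily.of_le {J : Finset ℕ} (hJ : AliveFamily s K r w φ J) (hφ : Coalescing s φ)
    (hrv : r ≤ v) (hvw : v ≤ w) : AliveFamily s K r v φ J where
  start_le := hJ.start_le
  mem := fun i hi q hq => hJ.mem i hi q ⟨hq.1, hq.2.trans hvw⟩
  injOn := fun i hi j hj hij => hJ.injOn hi hj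
    (hφ v i j ((hJ.start_le i hi).trans hrv) ((hJ.start_le j hj).trans hrv) hij w hvw)

lemma ManyAlive.of_le (hw : ManyAlive s K N r w n φ) (hφ : Coalescing s φ)
    (hrv : r ≤ v) (hvw : v ≤ w) : ManyAlive s K N r v n φ := by
  obtain ⟨J, hJN, hJn, hJ⟩ := hw
  exact ⟨J, hJN, hJn, hJ.of_le hφ hrv hvw⟩

/-- If the number of distinct surviving paths does not decrease during `[v, w]`, then all pairs
of distinct surviving paths survive. -/
lemma ManyAlive.pairSurvives (hw : ManyAlive s K N r w n φ) (hφ : Coalescing s φ)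
    (hrv : r ≤ v) (hvw : v ≤ w) (hv : ¬ ManyAlive s K N r v (n + 1) φ) {i j : ℕ}
    (hi : i < N) (hj : j < N) (his : s i ≤ r) (hjs : s j ≤ r)
    (hiK : ∀ q ∈ Icc r v, (φ i).path q ∈ K) (hjK : ∀ q ∈ Icc r v, (φ j).path q ∈ K)
    (hij : (φ i).path v ≠ (φ j).path v) : PairSurvives K v w (φ i) (φ j) := by
  obtain ⟨J, hJN, hJn, hJ⟩ := hw
  have hJv := hJ.of_le hφ hrv hvw
  -- Each path alive at `v` sits at the position of a member of `J`; otherwise adding it to `J`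
  -- would give `n + 1` positions.
  have key : ∀ i < N, s i ≤ r → (∀ q ∈ Icc r v, (φ i).path q ∈ K) →
      ∃ a ∈ J, (φ i).path v = (φ a).path v := by
    intro i hi his hiK
    by_contra! hne
    have hiJ : i ∉ J := fun h => hne i h rfl
    refine hv ⟨insert i J, ?_, by rw [Finset.card_insert_of_notMem hiJ, hJn], ?_, ?_, ?_⟩
    · exact Finset.insert_subset (Finset.mem_range.2 hi) hJN
    · simpa using ⟨his, hJv.start_le⟩
    · intro k hk
      rcases Finset.mem_insert.1 hk with rfl | hk
      · exact hiK
      · exact hJv.mem k hk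
    · rw [Finset.coe_insert, injOn_insert (by simpa using hiJ)]
      refine ⟨hJv.injOn, ?_⟩
      rintro ⟨a, ha, hai⟩
      exact hne a ha hai.symm
  obtain ⟨a, ha, hia⟩ := key i hi his hiK
  obtain ⟨b, hb, hjb⟩ := key j hj hjs hjK
  have hab : a ≠ b := by
    rintro rfl
    exact hij (hia.trans hjb.symm)
  have hiv := his.trans hrv
  have hjv := hjs.trans hrv
  have hia' := hφ v i a hiv ((hJ.start_le a ha).trans hrv) hia
  have hjb' := hφ v j b hjv ((hJ.start_le b hb).trans hrv) hjb
  refine fun q hq => ⟨?_, ?_, fun heq => hab (hJ.injOn ha hb ?_)⟩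
  · rw [hia' q hq.1]
    exact hJ.mem a ha q ⟨hrv.trans hq.1, hq.2⟩
  · rw [hjb' q hq.1]
    exact hJ.mem b hb q ⟨hrv.trans hq.1, hq.2⟩
  · change (φ a).path w = (φ b).path w
    rw [← hia' w hvw, ← hjb' w hvw]
    exact hφ q i j (hiv.trans hq.1) (hjv.trans hq.1) heq w hq.2

end

section

variable {M : Type*} [MetricSpace M] [TopologicalSpace.SeparableSpace M] [MeasurableSpace M]
  [BorelSpace M] {Ω : Type*} {s : ℕ → ℝ} {Φ : Ω → ℕ → PathSpace M}
  {K : Set M} {r v : ℝ}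

omit [TopologicalSpace.SeparableSpace M] in
lemma measurableSet_forall_mem_Icc (hK : IsClosed K) {i : ℕ} (hi : s i ≤ r) (hrv : r ≤ v) :
    MeasurableSet[pathFiltration s Φ v] {ω | ∀ q ∈ Icc r v, (Φ ω i).path q ∈ K} := by
  -- Clamping rational times to `[r, v]` gives a countable dense set of times, all within the range
  -- observed by `pathFiltration s Φ v`.
  have h1 : {ω | ∀ q ∈ Icc r v, (Φ ω i).path q ∈ K} =
      ⋂ q : ℚ, (fun ω => (Φ ω i).path (max r (min v q))) ⁻¹' K := by
    ext ω
    simp only [mem_ofPred_eq, mem_iInter, mem_preimage]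
    constructor
    · exact fun h q => h _ ⟨le_max_left _ _, max_le hrv (min_le_left _ _)⟩
    · intro h q hq
      have h2 : ∀ q : ℝ, (Φ ω i).path (max r (min v q)) ∈ K :=
        isClosed_property Rat.denseRange_cast (hK.preimage (by fun_prop)) h
      simpa [hq.1, hq.2] using h2 q
  rw [h1]
  exact @MeasurableSet.iInter _ _ (pathFiltration s Φ v) _ _ fun q =>
    measurable_path_pathFiltration s Φ (hi.trans (le_max_left _ _))
      (max_le hrv (min_le_left _ _)) hK.measurableSet

lemma measurableSet_path_eq {i j : ℕ} (hi : s i ≤ v) (hj : s j ≤ v) :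
    MeasurableSet[pathFiltration s Φ v] {ω | (Φ ω i).path v = (Φ ω j).path v} := by
  have : SecondCountableTopology M := UniformSpace.secondCountable_of_separable M
  let _ := pathFiltration s Φ v
  exact measurableSet_eq_fun (measurable_path_pathFiltration s Φ hi le_rfl)
    (measurable_path_pathFiltration s Φ hj le_rfl)

lemma measurableSet_dist_le {i j : ℕ} (hi : s i ≤ v) (hj : s j ≤ v) (ε : ℝ) :
    MeasurableSet[pathFiltration s Φ v]
      {ω | dist ((Φ ω i).path v) ((Φ ω j).path v) ≤ ε} := by
  have : SecondCountableTopology M := UniformSpace.secondCountable_of_separable M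
  let _ := pathFiltration s Φ v
  exact measurableSet_le (Measurable.dist (measurable_path_pathFiltration s Φ hi le_rfl)
    (measurable_path_pathFiltration s Φ hj le_rfl)) measurable_const

lemma measurableSet_manyAlive (hK : IsClosed K) (N n : ℕ) (hrv : r ≤ v) :
    MeasurableSet[pathFiltration s Φ v] {ω | ManyAlive s K N r v n (Φ ω)} := by
  let _ := pathFiltration s Φ v
  have h1 : {ω | ManyAlive s K N r v n (Φ ω)} = ⋃ J : Finset ℕ,
      {ω | J ⊆ Finset.range N ∧ J.card = n ∧ AliveFamily s K r v (Φ ω) J} := by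
    ext ω
    simp [ManyAlive]
  rw [h1]
  refine .iUnion fun J => ?_
  by_cases hJ : J ⊆ Finset.range N ∧ J.card = n ∧ ∀ i ∈ J, s i ≤ r
  · have h2 : {ω | J ⊆ Finset.range N ∧ J.card = n ∧ AliveFamily s K r v (Φ ω) J} =
        (⋂ i ∈ J, {ω | ∀ q ∈ Icc r v, (Φ ω i).path q ∈ K}) ∩
        ⋂ i ∈ J, ⋂ j ∈ J, ({ω | (Φ ω i).path v = (Φ ω j).path v}ᶜ ∪ {_ω | i = j}) := by
      ext ω
      simp only [mem_ofPred_eq, mem_inter_iff, mem_iInter, mem_union, mem_compl_iff]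
      constructor
      · rintro ⟨-, -, h⟩
        refine ⟨h.mem, fun i hi j hj => ?_⟩
        by_cases hij : i = j
        · exact Or.inr hij
        · exact Or.inl fun heq => hij (h.injOn hi hj heq)
      · rintro ⟨h3, h4⟩
        refine ⟨hJ.1, hJ.2.1, hJ.2.2, h3, fun i hi j hj hij => ?_⟩
        exact (h4 i hi j hj).resolve_left fun h => h hij
    rw [h2]
    refine MeasurableSet.inter (J.measurableSet_biInter fun i hi =>
      measurableSet_forall_mem_Icc hK (hJ.2.2 i hi) hrv) ?_
    refine J.measurableSet_biInter fun i hi => J.measurableSet_biInter fun j hj => ?_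
    exact (measurableSet_path_eq ((hJ.2.2 i hi).trans hrv)
      ((hJ.2.2 j hj).trans hrv)).compl.union (MeasurableSet.const _)
  · have h2 : {ω | J ⊆ Finset.range N ∧ J.card = n ∧ AliveFamily s K r v (Φ ω) J} = ∅ := by
      refine eq_empty_of_forall_notMem fun ω hω => hJ ⟨hω.1, hω.2.1, hω.2.2.start_le⟩
    rw [h2]
    exact MeasurableSet.empty

end

/-! ### Decrease of the number of surviving trajectories -/

/-- Used to select a close pair of paths that depends on `ω`: making the cover disjoint fixes the
pair on each piece, and the pieces stay measurable with respect to the past. -/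
lemma measure_inter_le_of_cover {Ω : Type*} [mΩ : MeasurableSpace Ω] {μ : Measure Ω}
    {m : MeasurableSpace Ω} (hm : m ≤ mΩ) {A R : Set Ω} {D : ℕ → Set Ω} {c : ℝ≥0∞}
    (hA : MeasurableSet[m] A) (hD : ∀ k, MeasurableSet[m] (D k)) (hAD : A ⊆ ⋃ k, D k)
    (h : ∀ k (A' : Set Ω), MeasurableSet[m] A' → A' ⊆ A ∩ D k → μ (A' ∩ R) ≤ c * μ A') :
    μ (A ∩ R) ≤ c * μ A := by
  have hd : ∀ k, MeasurableSet[m] (disjointed (fun k => A ∩ D k) k) := by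
    let _ := m
    exact MeasurableSet.disjointed fun k => hA.inter (hD k)
  have hU : ⋃ k, disjointed (fun k => A ∩ D k) k = A := by
    rw [iUnion_disjointed, ← inter_iUnion, inter_eq_left.2 hAD]
  calc μ (A ∩ R) = μ (⋃ k, disjointed (fun k => A ∩ D k) k ∩ R) := by
        rw [← iUnion_inter, hU]
    _ ≤ ∑' k, μ (disjointed (fun k => A ∩ D k) k ∩ R) := measure_iUnion_le _
    _ ≤ ∑' k, c * μ (disjointed (fun k => A ∩ D k) k) :=
        ENNReal.tsum_le_tsum fun k => h k _ (hd k) (disjointed_subset _ _)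
    _ = c * μ A := by
        rw [ENNReal.tsum_mul_left, ← measure_iUnion (disjoint_disjointed _)
          (fun k => hm _ (hd k)), hU]

section

variable {M : Type*} [MetricSpace M] [LocallyCompactSpace M] [TopologicalSpace.SeparableSpace M]
    [MeasurableSpace M] [BorelSpace M] {Ω : Type*} [MeasurableSpace Ω] {μ : Measure Ω}
    [IsProbabilityMeasure μ]
    {P : (n : ℕ) → ℝ≥0 → Kernel (Fin n → M) (Fin n → M)}
    {ψ : ℝ → ℝ → Ω → MeasMap M} {s : ℕ → ℝ} {x : ℕ → M} {Φ : Ω → ℕ → PathSpace M}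

/-- On `A` exactly `n` positions are occupied at `v`, two of them within `ε`. If `n` are left at `v
+ h'`, no pair of distinct survivors has met or left `K`, in particular not the close one. -/
lemma IsContinuousModification.measure_manyAlive_step (hP : ∀ n, IsFeller (P n))
    (hψ : IsStochasticFlow μ P ψ) (hΦ : IsContinuousModification μ ψ s x Φ)
    (hco : ∀ᵐ ω ∂μ, Coalescing s (Φ ω))
    {K : Set M} (hK : IsClosed K) {h h' : ℝ≥0} (hh : h < h') {ε : ℝ} {c : ℝ≥0∞}
    (hQ : ∀ y ∈ K, ∀ z ∈ K, dist y z ≤ ε → ∃ Q : Measure C(ℝ≥0, Fin 2 → M),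
      IsMarkovLaw (P 2) ![y, z] Q ∧ Q {w | (h : ℝ≥0∞) < min (exitTime K w) (meetingTime w)} ≤ c)
    {n : ℕ} (hn : ∀ S ⊆ K, (n : ℕ∞) ≤ S.encard → ∃ y ∈ S, ∃ z ∈ S, y ≠ z ∧ dist y z ≤ ε)
    {N : ℕ} {r v : ℝ} (hrv : r ≤ v) {A : Set Ω}
    (hA : MeasurableSet[pathFiltration s Φ v] A)
    (hAn : ∀ ω ∈ A, ManyAlive s K N r v n (Φ ω))
    (hAn' : ∀ ω ∈ A, ¬ ManyAlive s K N r v (n + 1) (Φ ω)) :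
    μ (A ∩ {ω | ManyAlive s K N r (v + h') n (Φ ω)}) ≤ c * μ A := by
  let S : ℕ → Set Ω := fun i => {ω | ∀ q ∈ Icc r v, (Φ ω i).path q ∈ K}
  let D' : ℕ → ℕ → Set Ω := fun i j => {_ω | i < N ∧ j < N ∧ s i ≤ r ∧ s j ≤ r} ∩ (S i ∩ S j ∩
    {ω | (Φ ω i).path v = (Φ ω j).path v}ᶜ ∩ {ω | dist ((Φ ω i).path v) ((Φ ω j).path v) ≤ ε})
  have hD' : ∀ i j, MeasurableSet[pathFiltration s Φ v] (D' i j) := by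
    intro i j
    let _ := pathFiltration s Φ v
    by_cases hij : i < N ∧ j < N ∧ s i ≤ r ∧ s j ≤ r
    · exact (MeasurableSet.const _).inter
        ((((measurableSet_forall_mem_Icc hK hij.2.2.1 hrv).inter
        (measurableSet_forall_mem_Icc hK hij.2.2.2 hrv)).inter
        (measurableSet_path_eq (hij.2.2.1.trans hrv) (hij.2.2.2.trans hrv)).compl).inter
        (measurableSet_dist_le (hij.2.2.1.trans hrv) (hij.2.2.2.trans hrv) ε))
    · have : D' i j = ∅ := eq_empty_of_forall_notMem fun ω hω => hij hω.1
      rw [this]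
      exact MeasurableSet.empty
  refine measure_inter_le_of_cover (hΦ.pathFiltration_le v)
    (D := fun k => D' k.unpair.1 k.unpair.2) hA (fun k => hD' _ _) ?_ ?_
  · intro ω hω
    obtain ⟨J, hJN, hJn, hJ⟩ := hAn ω hω
    obtain ⟨_, ⟨i, hi, rfl⟩, _, ⟨j, hj, rfl⟩, hne, hd⟩ :=
      hn ((fun i => (Φ ω i).path v) '' (J : Set ℕ))
      (by rintro _ ⟨i, hi, rfl⟩; exact hJ.mem i hi v ⟨hrv, le_rfl⟩)
      (by rw [hJ.injOn.encard_image, encard_coe_eq_coe_finsetCard, hJn])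
    refine mem_iUnion.2 ⟨Nat.pair i j, ?_⟩
    simp only [Nat.unpair_pair]
    exact ⟨⟨Finset.mem_range.1 (hJN hi), Finset.mem_range.1 (hJN hj), hJ.start_le i hi,
      hJ.start_le j hj⟩, ⟨⟨hJ.mem i hi, hJ.mem j hj⟩, hne⟩, hd⟩
  · intro k A' hA' hA'D
    generalize k.unpair.1 = i at hA'D
    generalize k.unpair.2 = j at hA'D
    -- The restrictions on the indices `i`, `j` do not depend on `ω`, so one point of `A'` reveals
    -- them.
    rcases A'.eq_empty_or_nonempty with rfl | ⟨ω₀, hω₀⟩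
    · simp
    obtain ⟨-, ⟨hi, hj, his, hjs⟩, -⟩ := hA'D hω₀
    refine le_trans (measure_mono_ae ?_) (hΦ.measure_pairSurvives_le hP hψ hK hh hQ
      (his.trans hrv) (hjs.trans hrv) hA' fun ω hω => ?_)
    · filter_upwards [hco] with ω hω hωA
      obtain ⟨h1, -, ⟨⟨hiK, hjK⟩, hij⟩, hd⟩ := hA'D hωA.1
      exact ⟨hωA.1, hωA.2.pairSurvives hω hrv (by simp) (hAn' ω h1) hi hj his hjs hiK hjK hij⟩
    · obtain ⟨h1, -, ⟨⟨hiK, hjK⟩, hij⟩, hd⟩ := hA'D hω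
      exact ⟨hiK v ⟨hrv, le_rfl⟩, hjK v ⟨hrv, le_rfl⟩, hd⟩

/-- Unless more than `n` positions were occupied at `v`, the count can still be `n` only if all `a`
successive trials of length `h'` failed; each contributes a factor `c`. -/
lemma IsContinuousModification.measure_manyAlive_iterate (hP : ∀ n, IsFeller (P n))
    (hψ : IsStochasticFlow μ P ψ) (hΦ : IsContinuousModification μ ψ s x Φ)
    (hco : ∀ᵐ ω ∂μ, Coalescing s (Φ ω))
    {K : Set M} (hK : IsClosed K) {h h' : ℝ≥0} (hh : h < h') {ε : ℝ} {c : ℝ≥0∞}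
    (hQ : ∀ y ∈ K, ∀ z ∈ K, dist y z ≤ ε → ∃ Q : Measure C(ℝ≥0, Fin 2 → M),
      IsMarkovLaw (P 2) ![y, z] Q ∧ Q {w | (h : ℝ≥0∞) < min (exitTime K w) (meetingTime w)} ≤ c)
    {n : ℕ} (hn : ∀ S ⊆ K, (n : ℕ∞) ≤ S.encard → ∃ y ∈ S, ∃ z ∈ S, y ≠ z ∧ dist y z ≤ ε)
    {N : ℕ} {r v : ℝ} (hrv : r ≤ v) (a : ℕ) :
    μ {ω | ManyAlive s K N r (v + a * h') n (Φ ω)} ≤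
      μ {ω | ManyAlive s K N r v (n + 1) (Φ ω)} + c ^ a := by
  let G : ℕ → ℝ → Set Ω := fun n v => {ω | ManyAlive s K N r v n (Φ ω)}
  have hva : ∀ a : ℕ, v ≤ v + a * h' := fun a => le_add_of_nonneg_right (by positivity)
  have key : ∀ a : ℕ, μ (G n (v + a * h') \ G (n + 1) v) ≤ c ^ a := by
    intro a
    induction a with
    | zero => simpa using prob_le_one
    | succ a ih =>
      -- By monotonicity of the count the last difference removes only a null set, but it makes the
      -- count exactly `n` for every `ω` in `A`.
      let A : Set Ω := (G n (v + a * h') \ G (n + 1) v) \ G (n + 1) (v + a * h')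
      have hA : MeasurableSet[pathFiltration s Φ (v + a * h')] A := by
        let _ := pathFiltration s Φ (v + a * h')
        refine MeasurableSet.diff (MeasurableSet.diff ?_ ?_) ?_
        · exact measurableSet_manyAlive hK N n (hrv.trans (hva a))
        · exact pathFiltration_mono s Φ (hva a) _ (measurableSet_manyAlive hK N (n + 1) hrv)
        · exact measurableSet_manyAlive hK N (n + 1) (hrv.trans (hva a))
      have h1 := hΦ.measure_manyAlive_step hP hψ hco hK hh hQ hn (N := N) (hrv.trans (hva a)) hA
        (fun ω hω => hω.1.1) (fun ω hω => hω.2)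
      have h2 : v + a * h' + h' = v + (a + 1 : ℕ) * h' := by push_cast; ring
      rw [h2] at h1
      calc μ (G n (v + (a + 1 : ℕ) * h') \ G (n + 1) v)
          ≤ μ (A ∩ G n (v + (a + 1 : ℕ) * h')) := by
            refine measure_mono_ae ?_
            filter_upwards [hco] with ω hω hωG
            refine ⟨⟨⟨hωG.1.of_le hω (hrv.trans (hva a)) ?_, hωG.2⟩, fun h => ?_⟩, hωG.1⟩
            · rw [← h2]; simp
            · exact hωG.2 (ManyAlive.of_le h hω hrv (hva a))
        _ ≤ c * μ A := h1
        _ ≤ c * c ^ a := by gcongr; exact (measure_mono sdiff_subset).trans ih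
        _ = c ^ (a + 1) := (pow_succ' c a).symm
  calc μ (G n (v + a * h')) ≤ μ (G (n + 1) v ∪ (G n (v + a * h') \ G (n + 1) v)) :=
        measure_mono (by rw [union_sdiff_self]; exact subset_union_right)
    _ ≤ μ (G (n + 1) v) + μ (G n (v + a * h') \ G (n + 1) v) := measure_union_le _ _
    _ ≤ _ := by gcongr; exact key a

end

/-! ### Descent through all levels and finiteness -/

/-- The number of trials per level: they take a summable time, and their failure probabilities
are summable. -/
lemma exists_trials {γ : ℝ} (hγ : 1 < γ) {c : ℝ} (hc1 : c < 1) :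
    ∃ a : ℕ → ℕ, Summable (fun n => (a n : ℝ) * (n : ℝ) ^ (-γ)) ∧
      ∑' n, ENNReal.ofReal c ^ a n ≠ ∞ := by
  -- In the application `c = 1 - p` may be zero or negative; `d` has a negative logarithm.
  obtain ⟨d, hcd, hd0, hd1⟩ : ∃ d : ℝ, c ≤ d ∧ 0 < d ∧ d < 1 :=
    ⟨max c (1 / 2), le_max_left _ _, by positivity, max_lt hc1 (by norm_num)⟩
  -- With this choice `γ - δ = (γ + 1) / 2 > 1`.
  set δ := (γ - 1) / 2 with hδ
  have hδ0 : 0 < δ := by rw [hδ]; linarith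
  refine ⟨fun n => ⌈(n : ℝ) ^ δ⌉₊, ?_, ?_⟩
  · have h1 : Summable fun n : ℕ => (n : ℝ) ^ (δ - γ) + (n : ℝ) ^ (-γ) :=
      (Real.summable_nat_rpow.2 (by rw [hδ]; linarith)).add
        (Real.summable_nat_rpow.2 (by linarith))
    refine Summable.of_nonneg_of_le (fun n => by positivity) (fun n => ?_) h1
    rcases n.eq_zero_or_pos with rfl | hn
    · simp [Real.zero_rpow hδ0.ne']
      positivity
    · have h2 : (⌈(n : ℝ) ^ δ⌉₊ : ℝ) ≤ (n : ℝ) ^ δ + 1 :=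
        (Nat.ceil_lt_add_one (by positivity)).le
      calc (⌈(n : ℝ) ^ δ⌉₊ : ℝ) * (n : ℝ) ^ (-γ) ≤ ((n : ℝ) ^ δ + 1) * (n : ℝ) ^ (-γ) := by
            gcongr
        _ = _ := by rw [add_mul, one_mul, ← Real.rpow_add (by exact_mod_cast hn), sub_eq_add_neg]
  · have h1 : Summable fun n : ℕ => d ^ ⌈(n : ℝ) ^ δ⌉₊ := by
      have hb : 0 < -Real.log d := neg_pos.2 (Real.log_neg hd0 hd1)
      have h2 : Summable fun n : ℕ => Real.exp (-(-Real.log d) * (n : ℝ) ^ δ) := by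
        refine summable_of_isBigO_nat (Real.summable_nat_rpow.2 (show (-2 : ℝ) < -1 by norm_num)) ?_
        have h3 := (isLittleO_exp_neg_mul_rpow_atTop hb (-2 / δ)).comp_tendsto
          ((tendsto_rpow_atTop hδ0).comp tendsto_natCast_atTop_atTop)
        refine h3.isBigO.congr (fun n => rfl) (fun n => ?_)
        simp only [Function.comp]
        rw [← Real.rpow_mul (by positivity), mul_div_cancel₀ _ hδ0.ne']
      refine Summable.of_nonneg_of_le (fun n => by positivity) (fun n => ?_) h2
      rw [neg_neg, Real.exp_mul, Real.exp_log hd0, ← Real.rpow_natCast]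
      exact Real.rpow_le_rpow_of_exponent_ge hd0 hd1.le (Nat.le_ceil _)
    refine ne_top_of_le_ne_top h1.tsum_ofReal_ne_top (ENNReal.tsum_le_tsum fun n => ?_)
    rw [ENNReal.ofReal_pow hd0.le]
    gcongr

/-- A bound for the probability that `m` paths survive, if for all `n ≥ m` the number of surviving
paths drops from `n` to `n - 1` within time `τ n`, up to probability `b n`. -/
lemma measure_manyAlive_le_of_step {M : Type*} [TopologicalSpace M] {Ω : Type*}
    [MeasurableSpace Ω] {μ : Measure Ω} {s : ℕ → ℝ} {Φ : Ω → ℕ → PathSpace M}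
    (hco : ∀ᵐ ω ∂μ, Coalescing s (Φ ω))
    {K : Set M} {N : ℕ} {r : ℝ} {τ : ℕ → ℝ} (hτ : ∀ n, 0 ≤ τ n) (hτs : Summable τ)
    {b : ℕ → ℝ≥0∞} {m : ℕ}
    (hstep : ∀ n, m ≤ n → ∀ v, r ≤ v → μ {ω | ManyAlive s K N r (v + τ n) n (Φ ω)} ≤
      μ {ω | ManyAlive s K N r v (n + 1) (Φ ω)} + b n)
    {t : ℝ} (ht : r + ∑' k, τ (k + m) ≤ t) :
    μ {ω | ManyAlive s K N r t m (Φ ω)} ≤ ∑' k, b (k + m) := by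
  have key : ∀ k, ∀ n, m ≤ n →
      μ {ω | ManyAlive s K N r (r + ∑ i ∈ Finset.range k, τ (i + n)) n (Φ ω)} ≤
      μ {ω | ManyAlive s K N r r (n + k) (Φ ω)} + ∑ i ∈ Finset.range k, b (i + n) := by
    intro k
    induction k with
    | zero => intro n _; simp
    | succ k ih =>
      intro n hn
      have h1 := hstep n hn (r + ∑ i ∈ Finset.range k, τ (i + (n + 1)))
        (le_add_of_nonneg_right (Finset.sum_nonneg fun i _ => hτ _))
      have h2 := ih (n + 1) (by omega)
      have e : ∀ i, i + 1 + n = i + (n + 1) := fun i => by omega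
      -- The term `i = 0` is split off: the lowest level `n` is treated last, after the descent from
      -- `n + 1 + k` to `n + 1`.
      rw [Finset.sum_range_succ', Finset.sum_range_succ', ← add_assoc r, ← add_assoc, zero_add]
      simp only [e]
      refine h1.trans ?_
      rw [show n + (k + 1) = n + 1 + k by omega]
      gcongr
  -- A descent from above `N` starts from an impossible event, so the bound is uniform in `N`.
  have hempty : {ω | ManyAlive s K N r r (m + (N + 1)) (Φ ω)} = ∅ := by
    refine eq_empty_of_forall_notMem fun ω hω => ?_
    obtain ⟨J, hJN, hJn, -⟩ := hω
    have := Finset.card_le_card hJN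
    rw [Finset.card_range] at this
    omega
  have hτs' : Summable fun k => τ (k + m) := (summable_nat_add_iff m).2 hτs
  calc μ {ω | ManyAlive s K N r t m (Φ ω)}
      ≤ μ {ω | ManyAlive s K N r (r + ∑ i ∈ Finset.range (N + 1), τ (i + m)) m (Φ ω)} := by
        refine measure_mono_ae ?_
        filter_upwards [hco] with ω hω h
        refine ManyAlive.of_le h hω
          (le_add_of_nonneg_right (Finset.sum_nonneg fun i _ => hτ _)) (le_trans ?_ ht)
        gcongr
        exact hτs'.sum_le_tsum _ fun i _ => hτ _
    _ ≤ μ {ω | ManyAlive s K N r r (m + (N + 1)) (Φ ω)} +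
          ∑ i ∈ Finset.range (N + 1), b (i + m) := key _ _ le_rfl
    _ ≤ ∑' k, b (k + m) := by
        rw [hempty, measure_empty, zero_add]
        exact ENNReal.sum_le_tsum _

section

variable {M : Type*} [MetricSpace M] [LocallyCompactSpace M] [TopologicalSpace.SeparableSpace M]
    [MeasurableSpace M] [BorelSpace M] {Ω : Type*} [MeasurableSpace Ω] {μ : Measure Ω}
    [IsProbabilityMeasure μ]
    {P : (n : ℕ) → ℝ≥0 → Kernel (Fin n → M) (Fin n → M)}
    {ψ : ℝ → ℝ → Ω → MeasMap M} {s : ℕ → ℝ} {x : ℕ → M} {Φ : Ω → ℕ → PathSpace M}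

/-- Almost surely, the paths that stay in `K` during `[r, t]` are at finitely many positions at
time `t`. -/
lemma IsContinuousModification.ae_finite (hP : ∀ n, IsFeller (P n))
    (hψ : IsStochasticFlow μ P ψ) (hΦ : IsContinuousModification μ ψ s x Φ)
    (hco : ∀ᵐ ω ∂μ, Coalescing s (Φ ω)) {K : Set M} (hK : IsClosed K)
    (hKP : PropertyP (P 2) K) {r t : ℝ} (hrt : r < t) :
    ∀ᵐ ω ∂μ, {y | ∃ n, s n ≤ r ∧ (∀ q ∈ Icc r t, (Φ ω n).path q ∈ K) ∧
      (Φ ω n).path t = y}.Finite := by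
  obtain ⟨α, β, κ, p, C, hα, hβ, hκ, hp, hC, hακ, hP1, hP2⟩ := hKP
  obtain ⟨a, ha, hac⟩ := exists_trials hακ (show 1 - p < 1 by linarith)
  -- This is the time `β ε ^ α` of (P1) for the distance `ε = C n ^ (-κ)` of (P2). Trials last `2 *
  -- h n` to leave the strict margin.
  let h : ℕ → ℝ≥0 := fun n => (β * (C * (n : ℝ) ^ (-κ)) ^ α).toNNReal
  let τ : ℕ → ℝ := fun n => a n * (2 * h n : ℝ≥0)
  let b : ℕ → ℝ≥0∞ := fun n => ENNReal.ofReal (1 - p) ^ a n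
  have hτ0 : ∀ n, 0 ≤ τ n := fun n => by positivity
  have hh : ∀ n : ℕ, (h n : ℝ) = β * (C * (n : ℝ) ^ (-κ)) ^ α := fun n =>
    Real.coe_toNNReal _ (by positivity)
  have hτs : Summable τ := by
    refine (ha.mul_left (2 * β * C ^ α)).congr fun n => ?_
    simp only [τ, NNReal.coe_mul, hh, NNReal.coe_ofNat]
    rw [Real.mul_rpow hC.le (by positivity), ← Real.rpow_mul (by positivity),
      show -κ * α = -(α * κ) by ring]
    ring
  have hstep : ∀ N n, 2 ≤ n → ∀ v, r ≤ v → μ {ω | ManyAlive s K N r (v + τ n) n (Φ ω)} ≤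
      μ {ω | ManyAlive s K N r v (n + 1) (Φ ω)} + b n := by
    intro N n hn v hv
    have hn0 : (0 : ℝ) < n := by exact_mod_cast (by omega : 0 < n)
    have hε : 0 < C * (n : ℝ) ^ (-κ) := by positivity
    have hhpos : 0 < h n := by
      rw [← NNReal.coe_pos, hh]
      positivity
    refine hΦ.measure_manyAlive_iterate hP hψ hco hK (h := h n) (h' := 2 * h n)
      (ε := C * (n : ℝ) ^ (-κ)) ?_ ?_ ?_ hv (a n)
    · rw [two_mul]
      exact lt_add_of_pos_left _ hhpos
    · intro y hy z hz hyz
      obtain ⟨Q, hQ, hQp⟩ := hP1 _ hε y hy z hz hyz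
      have := hQ.prob
      refine ⟨Q, hQ, ?_⟩
      rw [← ENNReal.ofReal_toReal (measure_ne_top Q _)]
      exact ENNReal.ofReal_le_ofReal hQp
    · exact fun S hS hSn => hP2 S hS n hn hSn
  have hmain : ∀ᶠ m in atTop, μ {ω | ∃ N, ManyAlive s K N r t m (Φ ω)} ≤ ∑' k, b (k + m) := by
    -- For large `m`, the descent from arbitrarily high levels to `m` fits into `[r, t]`.
    have h1 : ∀ᶠ m in atTop, ∑' k, τ (k + m) < t - r :=
      (tendsto_sum_nat_add τ).eventually_lt_const (sub_pos.2 hrt)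
    filter_upwards [h1, eventually_ge_atTop 2] with m hm hm2
    have h2 : {ω | ∃ N, ManyAlive s K N r t m (Φ ω)} =
        ⋃ N, {ω | ManyAlive s K N r t m (Φ ω)} := by ext; simp
    have h3 : Monotone fun N => {ω | ManyAlive s K N r t m (Φ ω)} := by
      rintro N N' hN ω ⟨J, hJN, hJ⟩
      exact ⟨J, hJN.trans (Finset.range_mono hN), hJ⟩
    rw [h2, h3.measure_iUnion]
    exact iSup_le fun N => measure_manyAlive_le_of_step hco hτ0 hτs
      (fun n hn => hstep N n (hm2.trans hn)) (by linarith)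
  have hlim : Tendsto (fun m => ∑' k, b (k + m)) atTop (𝓝 0) :=
    ENNReal.tendsto_sum_nat_add b hac
  have hnull : μ {ω | ∀ m, ∃ N, ManyAlive s K N r t m (Φ ω)} = 0 := by
    refine le_antisymm (ge_of_tendsto hlim ?_) zero_le
    filter_upwards [hmain] with m hm
    exact (measure_mono (ofPred_subset_ofPred.2 fun ω hω => hω m)).trans hm
  rw [← compl_mem_ae_iff] at hnull
  filter_upwards [hnull] with ω hω
  by_contra hinf
  refine hω fun m => ?_
  obtain ⟨T, hT, hTm⟩ := (show Set.Infinite _ from hinf).exists_subset_card_eq m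
  choose! n hn1 hn2 hn3 using fun y (hy : y ∈ T) => hT hy
  have hinj : (T : Set M).InjOn n := by
    intro y hy z hz hyz
    rw [← hn3 y hy, ← hn3 z hz, hyz]
  classical
  refine ⟨(T.image n).sup id + 1, T.image n, fun i hi => ?_, ?_, ?_, ?_, ?_⟩
  · exact Finset.mem_range.2 (Nat.lt_succ_of_le (Finset.le_sup (f := id) hi))
  · rw [Finset.card_image_of_injOn hinj, hTm]
  · simpa using hn1
  · simpa using hn2
  · intro i hi j hj hij
    simp only [Finset.coe_image, mem_image, Finset.mem_coe] at hi hj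
    obtain ⟨y, hy, rfl⟩ := hi
    obtain ⟨z, hz, rfl⟩ := hj
    simp only [hn3 y hy, hn3 z hz] at hij
    rw [hij]

end

end StochFlow

/-! ### From fixed compact sets and times to instantaneous coalescence -/

theorem mainTheorem7
    {M : Type*} [MetricSpace M] [LocallyCompactSpace M] [TopologicalSpace.SeparableSpace M]
    [MeasurableSpace M] [BorelSpace M]
    {Ω : Type*} [MeasurableSpace Ω] (μ : Measure Ω) [IsProbabilityMeasure μ]
    (P : (n : ℕ) → ℝ≥0 → Kernel (Fin n → M) (Fin n → M))
    (hP : StochFlow.IsCoalescingFamily P)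
    (hcont : StochFlow.HasContinuousTrajectories P)
    (ψ : ℝ → ℝ → Ω → StochFlow.MeasMap M)
    (hψ : StochFlow.IsStochasticFlow μ P ψ)
    (s : ℕ → ℝ) (x : ℕ → M) (hD : DenseRange (fun n => (s n, x n)))
    (Φ : Ω → ℕ → StochFlow.PathSpace M)
    (hΦ : StochFlow.IsContinuousModification μ ψ s x Φ)
    (hskel : ∀ᵐ ω ∂μ, StochFlow.IsSkeleton (Φ ω))
    (K : ℕ → Set M) (hKc : ∀ l, IsCompact (K l)) (hKmono : Monotone K)
    (hKexh : ⋃ l, interior (K l) = Set.univ)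
    (hKP : ∀ l, StochFlow.PropertyP (P 2) (K l))
    (hKpath : ∀ᵐ ω ∂μ, ∀ (k : ℕ) (u t : ℝ), u < t →
      ∃ l, k < l ∧ ∃ r, u < r ∧ r < t ∧
        ∀ n : ℕ, s n ≤ u → (Φ ω n).path t ∈ K k →
          ∀ v ∈ Set.Icc r t, (Φ ω n).path v ∈ K l) :
    ∀ᵐ ω ∂μ, StochFlow.HasICP (Φ ω) := by
  have hco : ∀ᵐ ω ∂μ, StochFlow.Coalescing s (Φ ω) := by
    filter_upwards [hskel] with ω hω q m n hm hn
    exact hω.coalescence q m n (by rwa [hΦ.start_eq]) (by rwa [hΦ.start_eq])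
  -- Rational times leave countably many null sets; all real `u < t` are reached below through `r <
  -- r' < t' < t`.
  have hfin : ∀ᵐ ω ∂μ, ∀ (l : ℕ) (r t : ℚ), (r : ℝ) < t →
      {y | ∃ n, s n ≤ r ∧ (∀ q ∈ Icc (r : ℝ) t, (Φ ω n).path q ∈ K l) ∧
        (Φ ω n).path t = y}.Finite := by
    simp only [ae_all_iff]
    exact fun l r t hrt => hΦ.ae_finite hP.feller hψ hco (hKc l).isClosed (hKP l) hrt
  filter_upwards [hco, hfin, hKpath] with ω hω hωfin hωpath u t hut y
  obtain ⟨k, hk⟩ := mem_iUnion.1 (hKexh.symm ▸ mem_univ y : y ∈ ⋃ l, interior (K l))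
  refine ⟨K k, mem_interior_iff_mem_nhds.1 hk, ?_⟩
  obtain ⟨l, -, r, hur, hrt, hr⟩ := hωpath k u t hut
  obtain ⟨r', hr', hr't⟩ := exists_rat_btwn hrt
  obtain ⟨t', ht', ht't⟩ := exists_rat_btwn hr't
  have hF := hωfin l r' t' ht'
  set F := {y | ∃ n, s n ≤ r' ∧ (∀ q ∈ Icc (r' : ℝ) t', (Φ ω n).path q ∈ K l) ∧
        (Φ ω n).path t' = y} with hFdef
  have hpos : ∀ z ∈ F, ∃ n, s n ≤ r' ∧ (Φ ω n).path t' = z := by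
    rintro z ⟨n, h1, -, h3⟩
    exact ⟨n, h1, h3⟩
  choose! g hg1 hg2 using hpos
  -- By coalescence, the position at `t` is a function of the position at the rational time `t'`,
  -- where only finitely many occur.
  refine (hF.image fun z => (Φ ω (g z)).path t).subset ?_
  rintro _ ⟨hyk, n, hn, rfl⟩
  rw [hΦ.start_eq] at hn
  have hnr : s n ≤ r' := hn.trans (hur.le.trans hr'.le)
  have hnF : (Φ ω n).path t' ∈ F :=
    ⟨n, hnr, fun q hq => hr n hn hyk q ⟨hr'.le.trans hq.1, hq.2.trans ht't.le⟩, rfl⟩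
  exact ⟨_, hnF, hω t' _ _ ((hg1 _ hnF).trans ht'.le) (hnr.trans ht'.le) (hg2 _ hnF) t ht't.le⟩
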